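/- Let $U\subseteq\mathbb{R}^2$ be open, let $f:U\to\mathbb{R}^2$ be of class $C^1$, and consider the planar system $\dot x=f(x)$. Let $p\in U$ be an equilibrium, $f(p)=0$, and let $\lambda_1,\lambda_2\in\mathbb{C}$ be the eigenvalues (with multiplicity) of the Jacobian matrix of $f$ at $p$. Suppose $\lambda_1\neq\lambda_2$. Then: (i) if $\lambda_1,\lambda_2$ are real and nonzero with the same sign, then $p$ is a node; (ii) if $\lambda_1,\lambda_2$ are real and nonzero with opposite signs, then $p$ is a saddle; (iii) if $\lambda_1,\lambda_2$ are non-real with nonzero real part, then $p$ is a focus. Here an incoming (outgoing) trajectory of $p$ is a solution $x$ in $U$, other than the constant solution $p$, defined on $[0,\infty)$ (on $(-\infty,0]$) with $x(t)\to p$ as $t\to\infty$ (as $t\to-\infty$); two of them are regarded as the same trajectory if, after translations of time, they agree for all sufficiently late (early) times. The equilibrium $p$ is attracting (repelling) if for every $\varepsilon>0$ there is $\delta>0$ such that each solution with $|x(0)-p|<\delta$ exists for all $t\ge 0$ (all $t\le 0$), satisfies $|x(t)-p|<\varepsilon$ there, and converges to $p$ as $t\to\infty$ (as $t\to-\infty$).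 A node (focus) is an attracting or repelling equilibrium $p$ such that, along every incoming, respectively outgoing, trajectory, the direction $d(t)=f(x(t))/|f(x(t))|$ converges to a constant unit vector (rotates infinitely many times, i.e. a continuous angle function of $d(t)$ exists and tends to $+\infty$ or to $-\infty$) as $x(t)\to p$. A saddle is an equilibrium with exactly two outgoing and exactly two incoming trajectories, which appear alternately around $p$: the four unit vectors $(x(t)-p)/|x(t)-p|$ have limits as $x(t)\to p$, the four limits are distinct, and outgoing and incoming ones alternate in their cyclic order on the unit circle. -/

import Mathlib

open Set Filter Topology

noncomputable section

/-- The Euclidean plane. -/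
abbrev Plane : Type := EuclideanSpace ℝ (Fin 2)

/-- The unit vector at angle `θ`. -/
def unitAt (θ : ℝ) : Plane := !₂[Real.cos θ, Real.sin θ]

/-- The direction of a vector: `v / |v|`. -/
def direction (v : Plane) : Plane := ‖v‖⁻¹ • v

/-- The Jacobian matrix of `f` at `p`: the `(i, j)` entry is `∂ fᵢ / ∂ xⱼ`. -/
def jacobian (f : Plane → Plane) (p : Plane) : Matrix (Fin 2) (Fin 2) ℝ :=
  Matrix.of fun i j => (fderiv ℝ f p (EuclideanSpace.single j 1)) i

/-- `x` solves `dx/dt = f(x)` on the time interval `I`, with values in the domain `U` of `f`. -/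
def IsSolutionOn (f : Plane → Plane) (U : Set Plane) (x : ℝ → Plane) (I : Set ℝ) : Prop :=
  ∀ t ∈ I, x t ∈ U ∧ HasDerivWithinAt x (f (x t)) I t

/-- An incoming trajectory of `p`: a solution on `[0, ∞)`, different from the rest point `p`,
which converges to `p` as `t → ∞`. -/
def IsIncoming (f : Plane → Plane) (U : Set Plane) (p : Plane) (x : ℝ → Plane) : Prop :=
  IsSolutionOn f U x (Ici 0) ∧ x 0 ≠ p ∧ Tendsto x atTop (𝓝 p)

/-- An outgoing trajectory of `p`: a solution on `(-∞, 0]`, different from the rest point `p`,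
which converges to `p` as `t → -∞`. -/
def IsOutgoing (f : Plane → Plane) (U : Set Plane) (p : Plane) (x : ℝ → Plane) : Prop :=
  IsSolutionOn f U x (Iic 0) ∧ x 0 ≠ p ∧ Tendsto x atBot (𝓝 p)

/-- All trajectories through points near `p` exist on `[0, ∞)`, stay near `p`, and converge
to `p` as `t → ∞`. -/
def IsAttracting (f : Plane → Plane) (U : Set Plane) (p : Plane) : Prop :=
  ∀ ε > 0, ∃ δ > 0, ∀ x₀ ∈ Metric.ball p δ,
    (∃ x : ℝ → Plane, x 0 = x₀ ∧ IsSolutionOn f U x (Ici 0)) ∧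
    ∀ x : ℝ → Plane, x 0 = x₀ → IsSolutionOn f U x (Ici 0) →
      (∀ t ≥ 0, x t ∈ Metric.ball p ε) ∧ Tendsto x atTop (𝓝 p)

/-- All trajectories through points near `p` exist on `(-∞, 0]`, stay near `p` there, and
converge to `p` as `t → -∞`. -/
def IsRepelling (f : Plane → Plane) (U : Set Plane) (p : Plane) : Prop :=
  ∀ ε > 0, ∃ δ > 0, ∀ x₀ ∈ Metric.ball p δ,
    (∃ x : ℝ → Plane, x 0 = x₀ ∧ IsSolutionOn f U x (Iic 0)) ∧
    ∀ x : ℝ → Plane, x 0 = x₀ → IsSolutionOn f U x (Iic 0) →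
      (∀ t ≤ 0, x t ∈ Metric.ball p ε) ∧ Tendsto x atBot (𝓝 p)

/-- `p` is attracting (repelling) and along each incoming (outgoing) trajectory the direction
of the velocity converges to a (unit) vector as the trajectory tends to `p`. -/
def IsNode (f : Plane → Plane) (U : Set Plane) (p : Plane) : Prop :=
  (IsAttracting f U p ∧ ∀ x, IsIncoming f U p x →
    ∃ v : Plane, ‖v‖ = 1 ∧ Tendsto (fun t => direction (f (x t))) atTop (𝓝 v)) ∨
  (IsRepelling f U p ∧ ∀ x, IsOutgoing f U p x →
    ∃ v : Plane, ‖v‖ = 1 ∧ Tendsto (fun t => direction (f (x t))) atBot (𝓝 v))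

/-- `p` is attracting (repelling) and along each incoming (outgoing) trajectory the direction
of the velocity rotates infinitely many times as the trajectory tends to `p`: it has a
continuous angle function `θ`, which tends to `+∞` or to `-∞`. -/
def IsFocus (f : Plane → Plane) (U : Set Plane) (p : Plane) : Prop :=
  (IsAttracting f U p ∧ ∀ x, IsIncoming f U p x →
    ∃ θ : ℝ → ℝ, ContinuousOn θ (Ici 0) ∧
      (∀ t ≥ 0, direction (f (x t)) = unitAt (θ t)) ∧
      (Tendsto θ atTop atTop ∨ Tendsto θ atTop atBot)) ∨
  (IsRepelling f U p ∧ ∀ x, IsOutgoing f U p x →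
    ∃ θ : ℝ → ℝ, ContinuousOn θ (Iic 0) ∧
      (∀ t ≤ 0, direction (f (x t)) = unitAt (θ t)) ∧
      (Tendsto θ atBot atTop ∨ Tendsto θ atBot atBot))

/-- Two solutions on `[0, ∞)` are the same trajectory: up to translations of time, they agree
for late times. -/
def SameIncoming (x y : ℝ → Plane) : Prop :=
  ∃ a ≥ 0, ∃ b ≥ 0, ∀ t ≥ 0, x (t + a) = y (t + b)

/-- Two solutions on `(-∞, 0]` are the same trajectory: up to translations of time, they agree
for early times. -/
def SameOutgoing (x y : ℝ → Plane) : Prop :=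
  ∃ a ≥ 0, ∃ b ≥ 0, ∀ t ≤ 0, x (t - a) = y (t - b)

/-- `p` has exactly two outgoing trajectories `u₁, u₂` and exactly two incoming trajectories
`s₁, s₂`; they have tangent directions at `p`, which appear around `p` in the alternating
cyclic order `u₁, s₁, u₂, s₂`. -/
def IsSaddle (f : Plane → Plane) (U : Set Plane) (p : Plane) : Prop :=
  ∃ u₁ s₁ u₂ s₂ : ℝ → Plane,
    IsOutgoing f U p u₁ ∧ IsOutgoing f U p u₂ ∧
    (∀ x, IsOutgoing f U p x → SameOutgoing x u₁ ∨ SameOutgoing x u₂) ∧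
    IsIncoming f U p s₁ ∧ IsIncoming f U p s₂ ∧
    (∀ x, IsIncoming f U p x → SameIncoming x s₁ ∨ SameIncoming x s₂) ∧
    ∃ a b c d : ℝ, a < b ∧ b < c ∧ c < d ∧ d < a + 2 * Real.pi ∧
      Tendsto (fun t => direction (u₁ t - p)) atBot (𝓝 (unitAt a)) ∧
      Tendsto (fun t => direction (s₁ t - p)) atTop (𝓝 (unitAt b)) ∧
      Tendsto (fun t => direction (u₂ t - p)) atBot (𝓝 (unitAt c)) ∧
      Tendsto (fun t => direction (s₂ t - p)) atTop (𝓝 (unitAt d))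

end

/-! Write A for the derivative of f at p. Since f is C¹, near p it agrees with a globally Lipschitz
field F such that F - A has a small Lipschitz constant (`exists_lipschitz_extension`); solutions of
F exist for all t ≥ 0, and they solve the original equation as long as they stay near p. Repelling
and outgoing statements are the attracting and incoming ones for -f with time reversed.

Nodes and foci attract because of a quadratic Lyapunov function (`isAttracting_of_lyapunov`).
Directions are controlled through the velocity v = f(x(t)), which satisfies v' = Df(x(t)) v with
Df(x(t)) → A. At a node, let y, z be the coordinates of v in an eigenbasis with eigenvalues b < a.
For each κ the form y² - κ²z² is either eventually nonnegative or eventually negative, so z/y → 0 or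
y/z → 0 (`sector_dichotomy`), and v/|v| tends to plus or minus an eigenvector. At a focus, the cross
product of w and A w is a definite quadratic form, so the angular speed of v is eventually bounded
away from zero with a fixed sign.

At a saddle with b < 0 < a, the form q = y² - z² increases along solutions, and also along
differences of two solutions, near p. A curve of this kind with q ≥ 0 cannot tend to zero unless it
vanishes (`EigenFrame.eq_zero_of_tendsto_zero`). Hence incoming trajectories eventually lie in q <
0, and two in the same half of that cone coincide after a time shift
(`IsIncoming.sameIncoming_of_pos`). A trajectory in each half is found by shooting
(`exists_solution_in_stable_cone`), and the dichotomy gives its tangent. -/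

/-! ### Global forward solutions of Lipschitz fields -/

section Flow

variable {E : Type*} [NormedAddCommGroup E] [NormedSpace ℝ E]

/-- The radial retraction onto the closed ball of radius `R` around the origin. -/
noncomputable def radialRetract (R : ℝ) (x : E) : E := (R / max R ‖x‖) • x

theorem radialRetract_of_norm_le {R : ℝ} (hR : 0 < R) {x : E} (hx : ‖x‖ ≤ R) :
    radialRetract R x = x := by
  simp [radialRetract, max_eq_left hx, div_self hR.ne']

theorem norm_radialRetract_le {R : ℝ} (hR : 0 < R) (x : E) : ‖radialRetract R x‖ ≤ R := by
  have hm : 0 < max R ‖x‖ := lt_max_of_lt_left hR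
  rw [radialRetract, norm_smul, Real.norm_of_nonneg (by positivity), div_mul_eq_mul_div,
    div_le_iff₀ hm]
  exact mul_le_mul_of_nonneg_left (le_max_right _ _) hR.le

theorem norm_radialRetract_le_norm {R : ℝ} (hR : 0 < R) (x : E) :
    ‖radialRetract R x‖ ≤ ‖x‖ := by
  have hm : 0 < max R ‖x‖ := lt_max_of_lt_left hR
  rw [radialRetract, norm_smul, Real.norm_of_nonneg (by positivity)]
  exact mul_le_of_le_one_left (norm_nonneg _) ((div_le_one hm).2 (le_max_left _ _))

/-- Moving the point at a fixed scale and then changing the scale each cost at most ‖x - y‖. This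
works in every normed space, where 1 may fail as a Lipschitz constant. -/
theorem lipschitzWith_radialRetract {R : ℝ} (hR : 0 < R) :
    LipschitzWith 2 (radialRetract R : E → E) := by
  refine LipschitzWith.of_dist_le_mul fun x y => ?_
  rw [dist_eq_norm, dist_eq_norm]
  have hm : 0 < max R ‖x‖ := lt_max_of_lt_left hR
  have hn : 0 < max R ‖y‖ := lt_max_of_lt_left hR
  have hsplit : radialRetract R x - radialRetract R y =
      (R / max R ‖x‖) • (x - y) + (R / max R ‖x‖ - R / max R ‖y‖) • y := by
    simp only [radialRetract]; module
  have h1 : ‖(R / max R ‖x‖) • (x - y)‖ ≤ ‖x - y‖ := by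
    rw [norm_smul, Real.norm_of_nonneg (by positivity)]
    exact mul_le_of_le_one_left (norm_nonneg _) ((div_le_one hm).2 (le_max_left _ _))
  have h2 : ‖(R / max R ‖x‖ - R / max R ‖y‖) • y‖ ≤ ‖x - y‖ := by
    have e : R / max R ‖x‖ - R / max R ‖y‖ =
        (R / max R ‖x‖) * ((max R ‖y‖ - max R ‖x‖) / max R ‖y‖) := by
      field_simp
    rw [e, norm_smul, norm_mul, Real.norm_of_nonneg (div_nonneg hR.le hm.le), norm_div,
      Real.norm_of_nonneg hn.le]
    have a1 : R / max R ‖x‖ ≤ 1 := (div_le_one hm).2 (le_max_left _ _)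
    have a2 : ‖max R ‖y‖ - max R ‖x‖‖ ≤ ‖x - y‖ := by
      rw [Real.norm_eq_abs, norm_sub_rev]
      calc |max R ‖y‖ - max R ‖x‖| ≤ max |R - R| |‖y‖ - ‖x‖| := abs_max_sub_max_le_max _ _ _ _
        _ = |‖y‖ - ‖x‖| := by simp
        _ ≤ ‖y - x‖ := abs_norm_sub_norm_le _ _
    have a3 : ‖y‖ / max R ‖y‖ ≤ 1 := (div_le_one hn).2 (le_max_right _ _)
    calc R / max R ‖x‖ * (‖max R ‖y‖ - max R ‖x‖‖ / max R ‖y‖) * ‖y‖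
        = R / max R ‖x‖ * (‖max R ‖y‖ - max R ‖x‖‖ * (‖y‖ / max R ‖y‖)) := by ring
      _ ≤ 1 * (‖x - y‖ * 1) := by gcongr
      _ = ‖x - y‖ := by ring
  calc ‖radialRetract R x - radialRetract R y‖ ≤ ‖x - y‖ + ‖x - y‖ := by
        rw [hsplit]; exact (norm_add_le _ _).trans (add_le_add h1 h2)
    _ = _ := by simp; ring

theorem HasDerivWithinAt.Ici_of_mem_Icc {x : ℝ → E} {x' : E} {a b t : ℝ}
    (h : HasDerivWithinAt x x' (Icc a b) t) (ht : t ∈ Ico a b) :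
    HasDerivWithinAt x x' (Ici t) t :=
  h.mono_of_mem_nhdsWithin (mem_of_superset (Icc_mem_nhdsGE ht.2) (Icc_subset_Icc_left ht.1))

/-- Two solutions of a globally Lipschitz equation diverge at most exponentially. -/
theorem dist_le_exp_of_lipschitzWith {F : E → E} {K : NNReal} (hF : LipschitzWith K F)
    {x y : ℝ → E} {T : ℝ}
    (hx : ∀ t ∈ Icc 0 T, HasDerivWithinAt x (F (x t)) (Icc 0 T) t)
    (hy : ∀ t ∈ Icc 0 T, HasDerivWithinAt y (F (y t)) (Icc 0 T) t) {t : ℝ} (ht : t ∈ Icc 0 T) :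
    dist (x t) (y t) ≤ dist (x 0) (y 0) * Real.exp (K * t) := by
  have h := dist_le_of_trajectories_ODE (v := fun _ => F) (K := K) (f := x) (g := y) (a := 0)
    (b := T) (δ := dist (x 0) (y 0)) (fun _ => hF)
    (fun t ht => (hx t ht).continuousWithinAt)
    (fun t ht => (hx t (Ico_subset_Icc_self ht)).Ici_of_mem_Icc ht)
    (fun t ht => (hy t ht).continuousWithinAt)
    (fun t ht => (hy t (Ico_subset_Icc_self ht)).Ici_of_mem_Icc ht) le_rfl t ht
  simpa using h

/-- Retracting the values of F to the ball of radius R makes the field bounded, so Picard–Lindelöf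
covers all of [0, T] with a ball of radius R T. Grönwall gives ‖x - p‖ ≤ B, hence ‖F(x)‖ ≤ K B < R,
so the retraction never acts on the solution found. -/
theorem exists_solution_Icc_of_lipschitzWith [CompleteSpace E] {F : E → E} {K : NNReal}
    (hF : LipschitzWith K F) {p : E} (hp : F p = 0) (x₀ : E) {T : ℝ} (hT : 0 ≤ T) :
    ∃ x : ℝ → E, x 0 = x₀ ∧ ∀ t ∈ Icc 0 T, HasDerivWithinAt x (F (x t)) (Icc 0 T) t := by
  set B : ℝ := ‖x₀ - p‖ * Real.exp (K * T) with hB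
  have hB0 : 0 ≤ B := by positivity
  set R : ℝ := K * B + 1 with hRdef
  have hR : 0 < R := by positivity
  have hnorm : ∀ y, ‖F y‖ ≤ K * ‖y - p‖ := fun y => by
    have := hF.dist_le_mul y p
    rwa [hp, dist_zero_right, dist_eq_norm] at this
  have hpl : IsPicardLindelof (fun _ => radialRetract R ∘ F) (⟨0, le_rfl, hT⟩ : Icc 0 T) x₀
      (⟨R * T, by positivity⟩ : NNReal) 0 ⟨R, hR.le⟩ (2 * K) := by
    refine ⟨fun t _ => ((lipschitzWith_radialRetract hR).comp hF).lipschitzOnWith,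
      fun y _ => continuousOn_const, fun t _ y _ => norm_radialRetract_le hR _, ?_⟩
    simp only [NNReal.coe_zero, sub_zero, sub_self]
    rw [max_eq_left hT]
    exact le_rfl
  obtain ⟨x, hx0, hx⟩ := hpl.exists_eq_forall_mem_Icc_hasDerivWithinAt₀
  simp only at hx0 hx
  refine ⟨x, hx0, fun t ht => ?_⟩
  have hbound : ‖x t - p‖ ≤ B := by
    have h := norm_le_gronwallBound_of_norm_deriv_right_le (f := fun t => x t - p)
      (f' := fun t => radialRetract R (F (x t))) (δ := ‖x₀ - p‖) (K := K) (ε := 0) (a := 0)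
      (b := T) (fun t ht => ((hx t ht).sub_const p).continuousWithinAt)
      (fun t ht => ((hx t (Ico_subset_Icc_self ht)).Ici_of_mem_Icc ht).sub_const p)
      (by simp [hx0]) (fun t _ => by
        simpa using (norm_radialRetract_le_norm hR _).trans (hnorm (x t))) t ht
    refine h.trans ?_
    rw [gronwallBound_ε0, hB]
    gcongr
    simpa using ht.2
  have e : radialRetract R (F (x t)) = F (x t) :=
    radialRetract_of_norm_le hR (by
      have : ‖F (x t)‖ ≤ K * B := (hnorm _).trans (by gcongr)
      linarith)
  have := hx t ht
  rwa [Function.comp_apply, e] at this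

/-- A globally Lipschitz vector field with a zero has solutions on `[0, ∞)`. -/
theorem exists_solution_Ici_of_lipschitzWith [CompleteSpace E] {F : E → E} {K : NNReal}
    (hF : LipschitzWith K F) {p : E} (hp : F p = 0) (x₀ : E) :
    ∃ x : ℝ → E, x 0 = x₀ ∧ ∀ t ∈ Ici 0, HasDerivWithinAt x (F (x t)) (Ici 0) t := by
  choose x hx0 hx using fun n : ℕ =>
    exists_solution_Icc_of_lipschitzWith hF hp x₀ (Nat.cast_nonneg (α := ℝ) n)
  have hagree : ∀ m n : ℕ, ∀ t : ℝ, 0 ≤ t → t ≤ m → t ≤ n → x m t = x n t := by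
    intro m n t h0 hm hn
    have hm' : Icc (0 : ℝ) t ⊆ Icc 0 m := Icc_subset_Icc_right hm
    have hn' : Icc (0 : ℝ) t ⊆ Icc 0 n := Icc_subset_Icc_right hn
    have := dist_le_exp_of_lipschitzWith hF (fun s hs => (hx m s (hm' hs)).mono hm')
      (fun s hs => (hx n s (hn' hs)).mono hn') (⟨h0, le_rfl⟩ : t ∈ Icc 0 t)
    rw [hx0, hx0, dist_self, zero_mul] at this
    exact dist_le_zero.1 this
  refine ⟨fun t => x ⌈t⌉₊ t, by simp [hx0], fun t ht => ?_⟩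
  -- The extra 1 makes t < n, so that [0, n] is a neighbourhood of t within [0, ∞) and the
  -- derivative transfers to the glued function.
  set n : ℕ := ⌈t⌉₊ + 1 with hn
  have htn : t < n := by
    rw [hn]; push_cast; linarith [Nat.le_ceil t]
  have hmem : Icc (0 : ℝ) n ∈ 𝓝[Ici 0] t := by
    rw [← Ici_inter_Iic]
    exact inter_mem self_mem_nhdsWithin (mem_nhdsWithin_of_mem_nhds (Iic_mem_nhds htn))
  have heq : ∀ s ∈ Icc (0 : ℝ) n, x ⌈s⌉₊ s = x n s := fun s hs =>
    hagree _ _ s hs.1 (Nat.le_ceil s) hs.2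
  have ht' : t ∈ Icc (0 : ℝ) n := ⟨ht, htn.le⟩
  have h := (hx n t ht').mono_of_mem_nhdsWithin hmem
  have e : x ⌈t⌉₊ t = x n t := heq t ht'
  simp only [e]
  exact h.congr_of_eventuallyEq (mem_of_superset hmem heq) (heq t ht')

end Flow

/-! ### One-sided differential inequalities -/

section Growth

/-- A function with `h' ≥ c h` on `[T, ∞)` grows at least like `exp (c t)`. -/
theorem exp_mul_le_of_deriv_ge {h h' : ℝ → ℝ} {c T : ℝ}
    (hd : ∀ t ∈ Ici T, HasDerivWithinAt h (h' t) (Ici T) t)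
    (hge : ∀ t ∈ Ici T, c * h t ≤ h' t) {s t : ℝ} (hs : T ≤ s) (hst : s ≤ t) :
    h s * Real.exp (c * (t - s)) ≤ h t := by
  have hexp : ∀ u : ℝ, HasDerivAt (fun u => Real.exp (-c * u)) (Real.exp (-c * u) * (-c)) u :=
    fun u => by simpa using ((hasDerivAt_id u).const_mul (-c)).exp
  have hmono : MonotoneOn (fun u => h u * Real.exp (-c * u)) (Ici T) := by
    refine monotoneOn_of_hasDerivWithinAt_nonneg (convex_Ici T)
      (f' := fun u => h' u * Real.exp (-c * u) + h u * (Real.exp (-c * u) * (-c)))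
      (fun u hu => ((hd u hu).mul (hexp u).hasDerivWithinAt).continuousWithinAt)
      (fun u hu => ?_) (fun u hu => ?_)
    · exact ((hd u (interior_subset hu)).mul (hexp u).hasDerivWithinAt).mono interior_subset
    · have := hge u (interior_subset hu)
      have e : h' u * Real.exp (-c * u) + h u * (Real.exp (-c * u) * (-c)) =
        (h' u - c * h u) * Real.exp (-c * u) := by ring
      rw [e]
      exact mul_nonneg (by linarith) (Real.exp_pos _).le
  have h1 := hmono (mem_Ici.2 hs) (mem_Ici.2 (hs.trans hst)) hst
  have h2 := mul_le_mul_of_nonneg_right h1 (Real.exp_pos (c * t)).le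
  have e1 : Real.exp (c * (t - s)) = Real.exp (-c * s) * Real.exp (c * t) := by
    rw [← Real.exp_add]; congr 1; ring
  have e2 : Real.exp (-c * t) * Real.exp (c * t) = 1 := by
    rw [← Real.exp_add]; simp
  calc h s * Real.exp (c * (t - s)) = h s * Real.exp (-c * s) * Real.exp (c * t) := by
        rw [e1, mul_assoc]
    _ ≤ h t * Real.exp (-c * t) * Real.exp (c * t) := h2
    _ = h t := by rw [mul_assoc, e2, mul_one]

/-- A function with `h' ≤ c h` on `[T, ∞)` grows at most like `exp (c t)`. -/
theorem le_exp_mul_of_deriv_le {h h' : ℝ → ℝ} {c T : ℝ}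
    (hd : ∀ t ∈ Ici T, HasDerivWithinAt h (h' t) (Ici T) t)
    (hle : ∀ t ∈ Ici T, h' t ≤ c * h t) {s t : ℝ} (hs : T ≤ s) (hst : s ≤ t) :
    h t ≤ h s * Real.exp (c * (t - s)) := by
  have := exp_mul_le_of_deriv_ge (h := fun t => -h t) (h' := fun t => -h' t) (c := c)
    (fun t ht => (hd t ht).neg) (fun t ht => by linarith [hle t ht]) hs hst
  linarith

theorem tendsto_exp_neg_mul_sub {c : ℝ} (hc : 0 < c) (s : ℝ) :
    Tendsto (fun t : ℝ => Real.exp (-c * (t - s))) atTop (𝓝 0) := by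
  refine Real.tendsto_exp_atBot.comp ?_
  exact (tendsto_id.atTop_add tendsto_const_nhds).const_mul_atTop_of_neg (by linarith)

/-- A nonnegative function with `S' ≤ -k S + o(1)` tends to zero. -/
theorem tendsto_zero_of_deriv_le_neg_mul_add {S S' : ℝ → ℝ} {k : ℝ} (hk : 0 < k)
    (hS0 : ∀ t, 0 ≤ S t)
    (hS : ∀ ε > 0, ∃ T, ∀ t ∈ Ici T, HasDerivWithinAt S (S' t) (Ici T) t ∧
      S' t ≤ -k * S t + ε) :
    Tendsto S atTop (𝓝 0) := by
  refine Metric.tendsto_atTop.2 fun η hη => ?_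
  -- With this error S - η/2 satisfies the homogeneous inequality h' ≤ -k h, so its upper bound
  -- decays and S drops below η.
  obtain ⟨T, hT⟩ := hS (k * (η / 2)) (by positivity)
  have hlim : Tendsto (fun t => (S T - η / 2) * Real.exp (-k * (t - T))) atTop (𝓝 0) := by
    simpa using (tendsto_exp_neg_mul_sub hk T).const_mul (S T - η / 2)
  obtain ⟨N, hN⟩ := eventually_atTop.1 (hlim.eventually (gt_mem_nhds (half_pos hη)))
  refine ⟨max N T, fun t ht => ?_⟩
  have h1 := le_exp_mul_of_deriv_le (h := fun t => S t - η / 2) (h' := S') (c := -k)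
    (fun t ht => (hT t ht).1.sub_const _) (fun t ht => by linarith [(hT t ht).2]) le_rfl
    ((le_max_right _ _).trans ht)
  have h2 := hN t ((le_max_left _ _).trans ht)
  rw [Real.dist_eq, sub_zero, abs_of_nonneg (hS0 t)]
  linarith

end Growth

/-! ### Uniqueness, time shifts and time reversal -/

section Solutions

variable {f : Plane → Plane} {U : Set Plane} {x y : ℝ → Plane}

theorem IsSolutionOn.mono {I J : Set ℝ} (h : IsSolutionOn f U x I) (hJ : J ⊆ I) :
    IsSolutionOn f U x J :=
  fun t ht => ⟨(h t (hJ ht)).1, (h t (hJ ht)).2.mono hJ⟩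

theorem IsSolutionOn.continuousOn {I : Set ℝ} (h : IsSolutionOn f U x I) : ContinuousOn x I :=
  fun t ht => (h t ht).2.continuousWithinAt

theorem IsSolutionOn.shift {a : ℝ} (h : IsSolutionOn f U x (Ici 0)) (ha : 0 ≤ a) :
    IsSolutionOn f U (fun t => x (t + a)) (Ici 0) := by
  intro t ht
  have ht' : t + a ∈ Ici (0 : ℝ) := add_nonneg ht ha
  refine ⟨(h _ ht').1, ?_⟩
  have := (h _ ht').2.scomp t (h := fun t => t + a) (s := Ici 0)
    ((hasDerivWithinAt_id t _).add_const a) (fun s hs => add_nonneg hs ha)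
  simpa [Function.comp_def] using this

theorem IsSolutionOn.reverse_of_Iic (h : IsSolutionOn f U x (Iic 0)) :
    IsSolutionOn (-f) U (fun t => x (-t)) (Ici 0) := by
  intro t ht
  have ht' : -t ∈ Iic (0 : ℝ) := neg_nonpos.2 (mem_Ici.1 ht)
  refine ⟨(h _ ht').1, ?_⟩
  have := (h _ ht').2.scomp t (h := fun t => -t) (s := Ici 0)
    (hasDerivWithinAt_id t _).neg (fun s hs => neg_nonpos.2 (mem_Ici.1 hs))
  simpa [Function.comp_def] using this

theorem IsSolutionOn.reverse_of_Ici (h : IsSolutionOn (-f) U x (Ici 0)) :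
    IsSolutionOn f U (fun t => x (-t)) (Iic 0) := by
  intro t ht
  have ht' : -t ∈ Ici (0 : ℝ) := neg_nonneg.2 (mem_Iic.1 ht)
  refine ⟨(h _ ht').1, ?_⟩
  have := (h _ ht').2.scomp t (h := fun t => -t) (s := Iic 0)
    (hasDerivWithinAt_id t _).neg (fun s hs => neg_nonneg.2 (mem_Iic.1 hs))
  simpa [Function.comp_def] using this

theorem ContDiffOn.locallyLipschitzOn_of_isOpen (hU : IsOpen U) (hf : ContDiffOn ℝ 1 f U) :
    LocallyLipschitzOn U f := by
  intro z hz
  obtain ⟨K, t, ht, hK⟩ := (hf.contDiffAt (hU.mem_nhds hz)).exists_lipschitzOnWith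
  exact ⟨K, t, mem_nhdsWithin_of_mem_nhds ht, hK⟩

/-- Solutions of a `C¹` equation on `[a, b]` which agree at `a` or at `b` are equal. -/
theorem IsSolutionOn.eqOn_Icc (hU : IsOpen U) (hf : ContDiffOn ℝ 1 f U) {a b : ℝ}
    (hx : IsSolutionOn f U x (Icc a b)) (hy : IsSolutionOn f U y (Icc a b))
    (h : x a = y a ∨ x b = y b) : EqOn x y (Icc a b) := by
  -- On U the field is only locally Lipschitz; on the compact union of the two arcs it has a single
  -- Lipschitz constant.
  set C : Set Plane := x '' Icc a b ∪ y '' Icc a b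
  have hC : IsCompact C := (isCompact_Icc.image_of_continuousOn hx.continuousOn).union
    (isCompact_Icc.image_of_continuousOn hy.continuousOn)
  have hCU : C ⊆ U := by
    rintro _ (⟨t, ht, rfl⟩ | ⟨t, ht, rfl⟩)
    exacts [(hx t ht).1, (hy t ht).1]
  obtain ⟨K, hK⟩ := LocallyLipschitzOn.exists_lipschitzOnWith_of_compact hC
    ((hf.locallyLipschitzOn_of_isOpen hU).mono hCU)
  have hxC : ∀ t ∈ Icc a b, x t ∈ C := fun t ht => Or.inl ⟨t, ht, rfl⟩
  have hyC : ∀ t ∈ Icc a b, y t ∈ C := fun t ht => Or.inr ⟨t, ht, rfl⟩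
  have hleft : ∀ {z : ℝ → Plane} {z' : Plane} {t : ℝ}, HasDerivWithinAt z z' (Icc a b) t →
      t ∈ Ioc a b → HasDerivWithinAt z z' (Iic t) t := fun hd ht =>
    hd.mono_of_mem_nhdsWithin (mem_of_superset (Icc_mem_nhdsLE ht.1) (Icc_subset_Icc_right ht.2))
  rcases h with h | h
  · exact ODE_solution_unique_of_mem_Icc_right (v := fun _ => f) (s := fun _ => C)
      (fun _ _ => hK) hx.continuousOn
      (fun t ht => (hx t (Ico_subset_Icc_self ht)).2.Ici_of_mem_Icc ht)
      (fun t ht => hxC t (Ico_subset_Icc_self ht)) hy.continuousOn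
      (fun t ht => (hy t (Ico_subset_Icc_self ht)).2.Ici_of_mem_Icc ht)
      (fun t ht => hyC t (Ico_subset_Icc_self ht)) h
  · exact ODE_solution_unique_of_mem_Icc_left (v := fun _ => f) (s := fun _ => C)
      (fun _ _ => hK) hx.continuousOn
      (fun t ht => hleft (hx t (Ioc_subset_Icc_self ht)).2 ht)
      (fun t ht => hxC t (Ioc_subset_Icc_self ht)) hy.continuousOn
      (fun t ht => hleft (hy t (Ioc_subset_Icc_self ht)).2 ht)
      (fun t ht => hyC t (Ioc_subset_Icc_self ht)) h

theorem IsSolutionOn.eqOn_Ici (hU : IsOpen U) (hf : ContDiffOn ℝ 1 f U)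
    (hx : IsSolutionOn f U x (Ici 0)) (hy : IsSolutionOn f U y (Ici 0)) {t₀ : ℝ} (ht₀ : 0 ≤ t₀)
    (h : x t₀ = y t₀) : EqOn x y (Ici 0) := by
  intro t ht
  have hsub : ∀ a b : ℝ, 0 ≤ a → Icc a b ⊆ Ici 0 := fun a b ha s hs => ha.trans hs.1
  rcases le_total t t₀ with hle | hle
  · exact IsSolutionOn.eqOn_Icc hU hf (hx.mono (hsub 0 t₀ le_rfl)) (hy.mono (hsub 0 t₀ le_rfl))
      (Or.inr h) ⟨ht, hle⟩
  · exact IsSolutionOn.eqOn_Icc hU hf (hx.mono (hsub t₀ t ht₀)) (hy.mono (hsub t₀ t ht₀))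
      (Or.inl h) ⟨hle, le_rfl⟩

theorem isSolutionOn_const {q : Plane} (hq : q ∈ U) (h : f q = 0) (I : Set ℝ) :
    IsSolutionOn f U (fun _ => q) I :=
  fun t _ => ⟨hq, by simpa [h] using hasDerivWithinAt_const t I q⟩

theorem IsIncoming.ne (hU : IsOpen U) (hf : ContDiffOn ℝ 1 f U) {p : Plane} (hpU : p ∈ U)
    (hp : f p = 0) (hx : IsIncoming f U p x) {t : ℝ} (ht : 0 ≤ t) : x t ≠ p := fun h =>
  hx.2.1 (IsSolutionOn.eqOn_Ici hU hf hx.1 (isSolutionOn_const hpU hp _) ht h self_mem_Ici)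

/-- A zero of f on the trajectory is a rest point, so by uniqueness the trajectory would be constant
and its limit p would be its starting point. -/
theorem IsIncoming.velocity_ne_zero (hU : IsOpen U) (hf : ContDiffOn ℝ 1 f U) {p : Plane}
    (hx : IsIncoming f U p x) {t : ℝ} (ht : 0 ≤ t) : f (x t) ≠ 0 := fun h => by
  have hconst := IsSolutionOn.eqOn_Ici hU hf hx.1 (isSolutionOn_const (hx.1 t ht).1 h _) ht rfl
  have hlim : Tendsto x atTop (𝓝 (x t)) :=
    tendsto_const_nhds.congr' ((eventually_ge_atTop 0).mono fun s hs => (hconst hs).symm)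
  have h0 : x 0 = x t := hconst self_mem_Ici
  exact hx.2.1 (h0.trans (tendsto_nhds_unique hlim hx.2.2))

end Solutions

/-! ### Dichotomy for perturbed diagonal systems -/

theorem quadratic_sector_bound {Y Z κ : ℝ} (hκ : 0 < κ) :
    (κ / (1 + κ) ^ 2) * ((Y + κ ^ 2 * Z) * (Y + Z)) ≤ Y ^ 2 + κ ^ 2 * Z ^ 2 := by
  rw [div_mul_eq_mul_div, div_le_iff₀ (by positivity)]
  have h : 0 ≤ (1 + κ + κ ^ 2) * (Y ^ 2 + κ ^ 2 * Z ^ 2) - κ * (1 + κ ^ 2) * (Y * Z) := by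
    have h1 : 0 ≤ (Y - κ * Z) ^ 2 := sq_nonneg _
    have h2 : 0 ≤ (1 + κ ^ 2) / 2 * (Y - κ * Z) ^ 2 := by positivity
    have h3 : 0 ≤ (1 + κ ^ 2) / 2 * (Y ^ 2 + κ ^ 2 * Z ^ 2) := by positivity
    have h4 : 0 ≤ κ * (Y ^ 2 + κ ^ 2 * Z ^ 2) := by positivity
    nlinarith
  nlinarith [mul_nonneg hκ.le (add_nonneg (sq_nonneg Y) (mul_nonneg (sq_nonneg κ) (sq_nonneg Z)))]

/-- For the exact diagonal system the form q = y² - κ²z² satisfies q' - (a + b) q = (a - b)(y² +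
κ²z²). The choice of a + b makes this surplus positive definite, and `quadratic_sector_bound` lets
it absorb the errors. -/
theorem sector_deriv_bound {y y' z z' a b κ ε : ℝ} (hab : b < a) (hκ : 0 < κ)
    (hε : 2 * ε ≤ (a - b) * (κ / (1 + κ) ^ 2)) (hy : |y' - a * y| ≤ ε * (|y| + |z|))
    (hz : |z' - b * z| ≤ ε * (|y| + |z|)) :
    (a + b) * (y ^ 2 - κ ^ 2 * z ^ 2) ≤ 2 * y * y' - κ ^ 2 * (2 * z * z') := by
  have h1 : -(|y| * (ε * (|y| + |z|))) ≤ y * (y' - a * y) :=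
    (neg_le_neg (by rw [abs_mul]; gcongr)).trans (neg_abs_le _)
  have h2 : z * (z' - b * z) ≤ |z| * (ε * (|y| + |z|)) :=
    (le_abs_self _).trans (by rw [abs_mul]; gcongr)
  have h3 := mul_le_mul_of_nonneg_left h2 (sq_nonneg κ)
  have h4 := mul_le_mul_of_nonneg_left (quadratic_sector_bound (Y := |y|) (Z := |z|) hκ)
    (sub_pos.2 hab).le
  have h5 := mul_le_mul_of_nonneg_right hε
    (by positivity : 0 ≤ (|y| + κ ^ 2 * |z|) * (|y| + |z|))
  rw [sq_abs, sq_abs] at h4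
  nlinarith

/-- The slope s = z/y obeys s' = -(a - b) s plus an error; inside the sector |s| ≤ 1/κ this error is
at most a constant times ε. -/
theorem ratio_deriv_bound {y y' z z' a b κ ε : ℝ} (hκ : 0 < κ) (hε : 0 ≤ ε)
    (hy0 : y ≠ 0) (hzy : κ * |z| ≤ |y|) (hy : |y' - a * y| ≤ ε * (|y| + |z|))
    (hz : |z' - b * z| ≤ ε * (|y| + |z|)) :
    2 * (z / y) * ((z' * y - z * y') / y ^ 2) ≤
      -(2 * (a - b)) * (z / y) ^ 2 + 2 * (1 + 1 / κ) ^ 3 * ε := by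
  set s := z / y with hs
  have hY : 0 < |y| := abs_pos.2 hy0
  have habs : |s| ≤ 1 / κ := by
    rw [hs, abs_div, div_le_div_iff₀ hY hκ]; linarith
  have hzs : |z| = |s| * |y| := by rw [hs, abs_div, div_mul_cancel₀ _ hY.ne']
  have e1 : |(y' - a * y) / y| ≤ ε * (1 + |s|) := by
    rw [abs_div, div_le_iff₀ hY]; rw [hzs] at hy; linarith
  have e2 : |(z' - b * z) / y| ≤ ε * (1 + |s|) := by
    rw [abs_div, div_le_iff₀ hY]; rw [hzs] at hz; linarith
  have expand : (z' * y - z * y') / y ^ 2 =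
      -(a - b) * s + ((z' - b * z) / y - s * ((y' - a * y) / y)) := by
    rw [hs]; field_simp; ring
  have err : |(z' - b * z) / y - s * ((y' - a * y) / y)| ≤ ε * (1 + 1 / κ) ^ 2 := by
    calc |(z' - b * z) / y - s * ((y' - a * y) / y)|
        ≤ |(z' - b * z) / y| + |s * ((y' - a * y) / y)| := abs_sub _ _
      _ ≤ ε * (1 + |s|) + |s| * (ε * (1 + |s|)) := by
          rw [abs_mul]; gcongr
      _ = ε * (1 + |s|) ^ 2 := by ring
      _ ≤ ε * (1 + 1 / κ) ^ 2 := by gcongr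
  have err2 : s * ((z' - b * z) / y - s * ((y' - a * y) / y)) ≤
      (1 + 1 / κ) * (ε * (1 + 1 / κ) ^ 2) := by
    refine (le_abs_self _).trans ?_
    rw [abs_mul]
    gcongr
    linarith
  rw [expand]
  nlinarith

/-- Perturbations `y' = a y + o(|y| + |z|)`, `z' = b z + o(|y| + |z|)` of a diagonal linear
system with `b < a`: every nonzero solution becomes tangent to one of the two axes. -/
theorem sector_dichotomy {y y' z z' : ℝ → ℝ} {a b : ℝ} (hab : b < a)
    (hy : ∀ t ∈ Ici 0, HasDerivWithinAt y (y' t) (Ici 0) t)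
    (hz : ∀ t ∈ Ici 0, HasDerivWithinAt z (z' t) (Ici 0) t)
    (hne : ∀ t ∈ Ici 0, y t ≠ 0 ∨ z t ≠ 0)
    (hsmall : ∀ ε > 0, ∀ᶠ t in atTop, |y' t - a * y t| ≤ ε * (|y t| + |z t|) ∧
      |z' t - b * z t| ≤ ε * (|y t| + |z t|)) :
    ((∀ᶠ t in atTop, y t ≠ 0) ∧ Tendsto (fun t => z t / y t) atTop (𝓝 0)) ∨
    ((∀ᶠ t in atTop, z t ≠ 0) ∧ Tendsto (fun t => y t / z t) atTop (𝓝 0)) := by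
  -- Past a time at which the errors are small, the form y² - κ²z² stays nonnegative once it is
  -- nonnegative.
  have key : ∀ κ > 0, (∀ᶠ t in atTop, κ * |z t| ≤ |y t|) ∨ (∀ᶠ t in atTop, |y t| < κ * |z t|) := by
    intro κ hκ
    have hpos : 0 < (a - b) * (κ / (1 + κ) ^ 2) := mul_pos (sub_pos.2 hab) (by positivity)
    obtain ⟨T, hT⟩ := eventually_atTop.1 (hsmall _ (half_pos hpos))
    set T₀ := max T 0
    have hsub : Ici T₀ ⊆ Ici 0 := Ici_subset_Ici.2 (le_max_right _ _)
    have hsq : ∀ t, (y t ^ 2 - κ ^ 2 * z t ^ 2 < 0 ↔ |y t| < κ * |z t|) := fun t => by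
      rw [sub_neg, ← mul_pow, sq_lt_sq, abs_mul, abs_of_pos hκ]
    by_cases h : ∃ s ∈ Ici T₀, 0 ≤ y s ^ 2 - κ ^ 2 * z s ^ 2
    · obtain ⟨s, hs, hqs⟩ := h
      refine Or.inl ((eventually_ge_atTop s).mono fun t ht => ?_)
      have := exp_mul_le_of_deriv_ge (h := fun t => y t ^ 2 - κ ^ 2 * z t ^ 2)
        (h' := fun t => 2 * y t * y' t - κ ^ 2 * (2 * z t * z' t)) (c := a + b) (T := T₀)
        (fun t ht => by
          have h1 := ((hy t (hsub ht)).mono hsub).pow 2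
          have h2 := (((hz t (hsub ht)).mono hsub).pow 2).const_mul (κ ^ 2)
          exact (h1.sub h2).congr_deriv (by simp))
        (fun t ht => by
          have := hT t ((le_max_left _ _).trans ht)
          exact sector_deriv_bound hab hκ (by linarith) this.1 this.2) hs ht
      have h0 : 0 ≤ y t ^ 2 - κ ^ 2 * z t ^ 2 :=
        (mul_nonneg hqs (Real.exp_pos _).le).trans this
      exact not_lt.1 fun hlt => absurd ((hsq t).2 hlt) (not_lt.2 h0)
    · push Not at h
      exact Or.inr ((eventually_ge_atTop T₀).mono fun t ht => (hsq t).1 (h t ht))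
  -- If the curve ends in one such sector, the slope equation drives z/y to 0. If it ends in none,
  -- then |y| < κ|z| eventually for every κ, which is y/z → 0.
  by_cases hcase : ∃ κ > 0, ∀ᶠ t in atTop, κ * |z t| ≤ |y t|
  · left
    obtain ⟨κ, hκ, hev⟩ := hcase
    have hy0 : ∀ t, 0 ≤ t → κ * |z t| ≤ |y t| → y t ≠ 0 := by
      intro t ht h h0
      rcases hne t ht with h1 | h1
      · exact h1 h0
      · rw [h0, abs_zero] at h
        have : 0 < κ * |z t| := mul_pos hκ (abs_pos.2 h1)
        linarith
    have hyne : ∀ᶠ t in atTop, y t ≠ 0 := by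
      filter_upwards [hev, eventually_ge_atTop 0] with t h ht using hy0 t ht h
    refine ⟨hyne, ?_⟩
    have hS : Tendsto (fun t => (z t / y t) ^ 2) atTop (𝓝 0) := by
      refine tendsto_zero_of_deriv_le_neg_mul_add
        (S' := fun t => 2 * (z t / y t) * ((z' t * y t - z t * y' t) / y t ^ 2))
        (k := 2 * (a - b)) (by linarith) (fun t => sq_nonneg _) fun ε hε => ?_
      have hε' : 0 < ε / (2 * (1 + 1 / κ) ^ 3) := by positivity
      obtain ⟨T, hT⟩ := eventually_atTop.1
        (hev.and ((eventually_ge_atTop 0).and (hsmall _ hε')))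
      have hsub : Ici T ⊆ Ici (0 : ℝ) := fun t ht => (hT t ht).2.1
      refine ⟨T, fun t ht => ?_⟩
      obtain ⟨h1, h2, h3, h4⟩ := hT t ht
      have hyt := hy0 t h2 h1
      constructor
      · have := (((hz t h2).mono hsub).div ((hy t h2).mono hsub) hyt).pow 2
        exact this.congr_deriv (by simp)
      · have := ratio_deriv_bound hκ hε'.le hyt h1 h3 h4
        rwa [mul_div_cancel₀ _ (by positivity)] at this
    have := hS.sqrt
    simp only [Real.sqrt_sq_eq_abs, Real.sqrt_zero] at this
    exact (tendsto_zero_iff_abs_tendsto_zero _).2 this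
  · right
    push Not at hcase
    have hlt : ∀ κ > 0, ∀ᶠ t in atTop, |y t| < κ * |z t| := fun κ hκ =>
      (key κ hκ).resolve_left fun h =>
      ((hcase κ hκ).and_eventually h).exists.elim fun t ht => absurd ht.2 (not_le.2 ht.1)
    have hz0 : ∀ᶠ t in atTop, z t ≠ 0 := by
      filter_upwards [hlt 1 one_pos] with t ht h0
      rw [h0, abs_zero, mul_zero] at ht
      exact absurd (abs_nonneg (y t)) (not_le.2 ht)
    refine ⟨hz0, Metric.tendsto_nhds.2 fun ε hε => ?_⟩
    filter_upwards [hlt ε hε, hz0] with t h1 h2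
    rw [Real.dist_eq, sub_zero, abs_div, div_lt_iff₀ (abs_pos.2 h2)]
    exact h1

theorem eventually_pos_or_neg {y : ℝ → ℝ} (hy : ContinuousOn y (Ici 0))
    (hne : ∀ᶠ t in atTop, y t ≠ 0) : (∀ᶠ t in atTop, 0 < y t) ∨ (∀ᶠ t in atTop, y t < 0) := by
  obtain ⟨T, hT⟩ := eventually_atTop.1 hne
  set T₀ := max T 0
  have hsub : Ici T₀ ⊆ Ici (0 : ℝ) := Ici_subset_Ici.2 (le_max_right _ _)
  have hne' : ∀ t ∈ Ici T₀, y t ≠ 0 := fun t ht => hT t ((le_max_left _ _).trans ht)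
  have himg := (isPreconnected_Ici (a := T₀)).image y (hy.mono hsub)
  by_contra! hcon
  obtain ⟨h1, h2⟩ := hcon
  obtain ⟨s, hs, hs'⟩ := (frequently_atTop.1 h1) T₀
  obtain ⟨t, ht, ht'⟩ := (frequently_atTop.1 h2) T₀
  obtain ⟨u, hu, hu0⟩ := himg.ordConnected.out (mem_image_of_mem y hs) (mem_image_of_mem y ht)
    ⟨hs', ht'⟩
  exact hne' u hu hu0

/-! ### Directions and eigenframes -/

theorem direction_smul {c : ℝ} (hc : 0 < c) (v : Plane) : direction (c • v) = direction v := by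
  rw [direction, direction, norm_smul, Real.norm_of_nonneg hc.le, smul_smul, mul_inv,
    mul_assoc, mul_comm ‖v‖⁻¹, ← mul_assoc, inv_mul_cancel₀ hc.ne', one_mul]

theorem direction_neg (v : Plane) : direction (-v) = -direction v := by
  simp [direction]

theorem continuousAt_direction {v : Plane} (hv : v ≠ 0) : ContinuousAt direction v :=
  (continuousAt_id.norm.inv₀ (norm_ne_zero_iff.2 hv)).smul continuousAt_id

theorem tendsto_direction_of_ratio {y z : ℝ → ℝ} {e₁ e₂ : Plane} (he : ‖e₁‖ = 1)
    (hy : ∀ᶠ t in atTop, 0 < y t) (hzy : Tendsto (fun t => z t / y t) atTop (𝓝 0)) :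
    Tendsto (fun t => direction (y t • e₁ + z t • e₂)) atTop (𝓝 e₁) := by
  have h1 : Tendsto (fun t => e₁ + (z t / y t) • e₂) atTop (𝓝 e₁) := by
    simpa using (hzy.smul_const e₂).const_add e₁
  have he0 : e₁ ≠ 0 := fun h => by simp [h] at he
  have h2 := (continuousAt_direction he0).tendsto.comp h1
  have e : direction e₁ = e₁ := by simp [direction, he]
  rw [e] at h2
  refine h2.congr' (hy.mono fun t ht => ?_)
  rw [Function.comp_apply, ← direction_smul ht, smul_add, smul_smul, mul_div_cancel₀ _ ht.ne']

/-- A normalized eigenbasis of `A` for the eigenvalues `a, b`, with its dual basis. -/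
structure EigenFrame (A : Plane →L[ℝ] Plane) (a b : ℝ) where
  e₁ : Plane
  e₂ : Plane
  l₁ : Plane →L[ℝ] ℝ
  l₂ : Plane →L[ℝ] ℝ
  norm_e₁ : ‖e₁‖ = 1
  norm_e₂ : ‖e₂‖ = 1
  l₁_e₁ : l₁ e₁ = 1
  l₁_e₂ : l₁ e₂ = 0
  l₂_e₁ : l₂ e₁ = 0
  l₂_e₂ : l₂ e₂ = 1
  l₁_map : ∀ w, l₁ (A w) = a * l₁ w
  l₂_map : ∀ w, l₂ (A w) = b * l₂ w
  decomp : ∀ w, l₁ w • e₁ + l₂ w • e₂ = w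

namespace EigenFrame

variable {A : Plane →L[ℝ] Plane} {a b : ℝ}

/-- The frame with the two eigenvectors interchanged. -/
def swap (S : EigenFrame A a b) : EigenFrame A b a :=
  ⟨S.e₂, S.e₁, S.l₂, S.l₁, S.norm_e₂, S.norm_e₁, S.l₂_e₂, S.l₂_e₁, S.l₁_e₂, S.l₁_e₁,
    S.l₂_map, S.l₁_map, fun w => by rw [add_comm, S.decomp]⟩

/-- The same frame, for the opposite map. -/
def neg (S : EigenFrame A a b) : EigenFrame (-A) (-a) (-b) :=
  ⟨S.e₁, S.e₂, S.l₁, S.l₂, S.norm_e₁, S.norm_e₂, S.l₁_e₁, S.l₁_e₂, S.l₂_e₁, S.l₂_e₂,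
    fun w => by simp [S.l₁_map], fun w => by simp [S.l₂_map], S.decomp⟩

/-- The frame with the first eigenvector reversed. -/
def flip (S : EigenFrame A a b) : EigenFrame A a b :=
  ⟨-S.e₁, S.e₂, -S.l₁, S.l₂, by simp [S.norm_e₁], S.norm_e₂, by simp [S.l₁_e₁],
    by simp [S.l₁_e₂], by simp [S.l₂_e₁], S.l₂_e₂, fun w => by simp [S.l₁_map], S.l₂_map,
    fun w => by simpa using S.decomp w⟩

theorem norm_le (S : EigenFrame A a b) (w : Plane) : ‖w‖ ≤ |S.l₁ w| + |S.l₂ w| := by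
  conv_lhs => rw [← S.decomp w]
  refine (norm_add_le _ _).trans ?_
  simp [norm_smul, S.norm_e₁, S.norm_e₂]

theorem ne_zero (S : EigenFrame A a b) {w : Plane} (hw : w ≠ 0) : S.l₁ w ≠ 0 ∨ S.l₂ w ≠ 0 := by
  by_contra! h
  exact hw (by rw [← S.decomp w, h.1, h.2]; simp)

theorem coord_bounds (S : EigenFrame A a b) {w w' : Plane} {ε : ℝ} (hε : 0 ≤ ε)
    (h : ‖w' - A w‖ ≤ ε / (‖S.l₁‖ + ‖S.l₂‖ + 1) * ‖w‖) :
    |S.l₁ w' - a * S.l₁ w| ≤ ε * (|S.l₁ w| + |S.l₂ w|) ∧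
    |S.l₂ w' - b * S.l₂ w| ≤ ε * (|S.l₁ w| + |S.l₂ w|) := by
  set C := ‖S.l₁‖ + ‖S.l₂‖ + 1 with hC
  have hC0 : 0 < C := by positivity
  have gen : ∀ l : Plane →L[ℝ] ℝ, ‖l‖ ≤ C → |l (w' - A w)| ≤ ε * (|S.l₁ w| + |S.l₂ w|) := by
    intro l hl
    calc |l (w' - A w)| ≤ ‖l‖ * ‖w' - A w‖ := l.le_opNorm _
      _ ≤ C * (ε / C * ‖w‖) := by gcongr
      _ = ε * ‖w‖ := by field_simp
      _ ≤ _ := by gcongr; exact S.norm_le w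
  rw [← S.l₁_map, ← S.l₂_map, ← map_sub, ← map_sub]
  exact ⟨gen _ (by rw [hC]; linarith [norm_nonneg S.l₂]),
    gen _ (by rw [hC]; linarith [norm_nonneg S.l₁])⟩

theorem dichotomy (S : EigenFrame A a b) (hab : b < a) {w w' : ℝ → Plane}
    (hw : ∀ t ∈ Ici 0, HasDerivWithinAt w (w' t) (Ici 0) t) (hw0 : ∀ t ∈ Ici 0, w t ≠ 0)
    (hsmall : ∀ ε > 0, ∀ᶠ t in atTop, ‖w' t - A (w t)‖ ≤ ε * ‖w t‖) :
    ((∀ᶠ t in atTop, S.l₁ (w t) ≠ 0) ∧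
      Tendsto (fun t => S.l₂ (w t) / S.l₁ (w t)) atTop (𝓝 0)) ∨
    ((∀ᶠ t in atTop, S.l₂ (w t) ≠ 0) ∧
      Tendsto (fun t => S.l₁ (w t) / S.l₂ (w t)) atTop (𝓝 0)) := by
  refine sector_dichotomy hab (fun t ht => S.l₁.hasFDerivAt.comp_hasDerivWithinAt t (hw t ht))
    (fun t ht => S.l₂.hasFDerivAt.comp_hasDerivWithinAt t (hw t ht))
    (fun t ht => S.ne_zero (hw0 t ht)) fun ε hε => ?_
  filter_upwards [hsmall (ε / (‖S.l₁‖ + ‖S.l₂‖ + 1)) (by positivity)] with t ht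
  exact S.coord_bounds hε.le ht

theorem tendsto_direction_of_pos (S : EigenFrame A a b) {w : ℝ → Plane}
    (hy : ∀ᶠ t in atTop, 0 < S.l₁ (w t))
    (hzy : Tendsto (fun t => S.l₂ (w t) / S.l₁ (w t)) atTop (𝓝 0)) :
    Tendsto (fun t => direction (w t)) atTop (𝓝 S.e₁) := by
  have := tendsto_direction_of_ratio (e₂ := S.e₂) S.norm_e₁ hy hzy
  simpa only [S.decomp] using this

theorem exists_tendsto_direction_of_ne (S : EigenFrame A a b) {w : ℝ → Plane}
    (hw : ContinuousOn w (Ici 0)) (hy : ∀ᶠ t in atTop, S.l₁ (w t) ≠ 0)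
    (hzy : Tendsto (fun t => S.l₂ (w t) / S.l₁ (w t)) atTop (𝓝 0)) :
    ∃ v : Plane, ‖v‖ = 1 ∧ Tendsto (fun t => direction (w t)) atTop (𝓝 v) := by
  rcases eventually_pos_or_neg (S.l₁.continuous.comp_continuousOn hw) hy with h | h
  · exact ⟨S.e₁, S.norm_e₁, S.tendsto_direction_of_pos h hzy⟩
  · refine ⟨S.flip.e₁, S.flip.norm_e₁, S.flip.tendsto_direction_of_pos
      (h.mono fun t ht => ?_) ?_⟩
    · simpa [flip] using ht
    · simpa [flip, div_neg] using hzy.neg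

theorem exists_tendsto_direction (S : EigenFrame A a b) (hab : b < a) {w w' : ℝ → Plane}
    (hw : ∀ t ∈ Ici 0, HasDerivWithinAt w (w' t) (Ici 0) t) (hw0 : ∀ t ∈ Ici 0, w t ≠ 0)
    (hsmall : ∀ ε > 0, ∀ᶠ t in atTop, ‖w' t - A (w t)‖ ≤ ε * ‖w t‖) :
    ∃ v : Plane, ‖v‖ = 1 ∧ Tendsto (fun t => direction (w t)) atTop (𝓝 v) := by
  have hc : ContinuousOn w (Ici 0) := fun t ht => (hw t ht).continuousWithinAt
  rcases S.dichotomy hab hw hw0 hsmall with ⟨h1, h2⟩ | ⟨h1, h2⟩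
  · exact S.exists_tendsto_direction_of_ne hc h1 h2
  · exact S.swap.exists_tendsto_direction_of_ne hc h1 h2

end EigenFrame

/-! ### Comparison of f with its derivative at p -/

section Linearization

variable {f : Plane → Plane} {U : Set Plane} {p : Plane}

/-- Near a point, a `C¹` map coincides with a global perturbation of its derivative by a map
with small Lipschitz constant. -/
theorem exists_lipschitz_extension (hU : IsOpen U) (hf : ContDiffOn ℝ 1 f U) (hpU : p ∈ U)
    {ε : ℝ} (hε : 0 < ε) :
    ∃ r > 0, Metric.ball p r ⊆ U ∧ ∃ (F : Plane → Plane) (K : NNReal), LipschitzWith K F ∧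
      EqOn F f (Metric.ball p r) ∧ ∀ x y, ‖F x - F y - fderiv ℝ f p (x - y)‖ ≤ ε * ‖x - y‖ := by
  set A := fderiv ℝ f p
  have hstrict : HasStrictFDerivAt f A p :=
    (hf.contDiffAt (hU.mem_nhds hpU)).hasStrictFDerivAt one_ne_zero
  set C := lipschitzExtensionConstant Plane
  have hC : 0 < C := lipschitzExtensionConstant_pos Plane
  -- Extending a vector-valued Lipschitz map multiplies its constant by C; dividing in advance
  -- leaves exactly ε.
  set c : NNReal := ⟨ε, hε.le⟩ / C with hc
  have hc0 : 0 < c := div_pos (show (0 : NNReal) < ⟨ε, hε.le⟩ from hε) hC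
  obtain ⟨s, hs, happ⟩ := hstrict.approximates_deriv_on_nhds (Or.inr hc0)
  obtain ⟨r, hr, hball⟩ := Metric.mem_nhds_iff.1 (inter_mem hs (hU.mem_nhds hpU))
  have hlip : LipschitzOnWith c (fun x => f x - A x) (Metric.ball p r) := by
    refine LipschitzOnWith.of_dist_le_mul fun x hx y hy => ?_
    have := happ x (hball hx).1 y (hball hy).1
    rw [dist_eq_norm, dist_eq_norm]
    have e : f x - A x - (f y - A y) = f x - f y - A (x - y) := by rw [map_sub]; abel
    rw [e]
    exact this
  obtain ⟨g, hg, hgf⟩ := hlip.extend_finite_dimension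
  have hCc : C * c = ⟨ε, hε.le⟩ := mul_div_cancel₀ _ hC.ne'
  rw [hCc] at hg
  refine ⟨r, hr, fun x hx => (hball hx).2, fun x => A x + g x, ‖A‖₊ + ⟨ε, hε.le⟩,
    A.lipschitz.add hg, fun x hx => ?_, fun x y => ?_⟩
  · simp [← hgf hx]
  · have := hg.dist_le_mul x y
    rw [dist_eq_norm, dist_eq_norm] at this
    have e : A x + g x - (A y + g y) - A (x - y) = g x - g y := by rw [map_sub]; abel
    rw [e]
    exact this

/-- The variational equation. It makes the velocity itself an asymptotically linear curve, although
f is only C¹. -/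
theorem IsIncoming.hasDerivWithinAt_velocity (hU : IsOpen U) (hf : ContDiffOn ℝ 1 f U)
    {x : ℝ → Plane} (hx : IsIncoming f U p x) {t : ℝ} (ht : t ∈ Ici (0 : ℝ)) :
    HasDerivWithinAt (fun t => f (x t)) (fderiv ℝ f (x t) (f (x t))) (Ici 0) t :=
  (((hf.contDiffAt (hU.mem_nhds (hx.1 t ht).1)).differentiableAt
    one_ne_zero).hasFDerivAt).comp_hasDerivWithinAt t (hx.1 t ht).2

theorem IsIncoming.eventually_velocity_le (hU : IsOpen U) (hf : ContDiffOn ℝ 1 f U)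
    (hpU : p ∈ U) {x : ℝ → Plane} (hx : IsIncoming f U p x) {ε : ℝ} (hε : 0 < ε) :
    ∀ᶠ t in atTop, ‖fderiv ℝ f (x t) (f (x t)) - fderiv ℝ f p (f (x t))‖ ≤ ε * ‖f (x t)‖ := by
  have hc : ContinuousAt (fderiv ℝ f) p :=
    (hf.continuousOn_fderiv_of_isOpen hU le_rfl).continuousAt (hU.mem_nhds hpU)
  have := (hc.tendsto.comp hx.2.2).eventually (Metric.ball_mem_nhds _ hε)
  filter_upwards [this] with t ht
  rw [Function.comp_apply, dist_eq_norm] at ht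
  rw [← sub_apply]
  exact (ContinuousLinearMap.le_opNorm _ _).trans (by gcongr)

theorem IsIncoming.eventually_displacement_le (hU : IsOpen U) (hf : ContDiffOn ℝ 1 f U)
    (hpU : p ∈ U) (hp : f p = 0) {x : ℝ → Plane} (hx : IsIncoming f U p x) {ε : ℝ}
    (hε : 0 < ε) :
    ∀ᶠ t in atTop, ‖f (x t) - fderiv ℝ f p (x t - p)‖ ≤ ε * ‖x t - p‖ := by
  have hd := ((hf.contDiffAt (hU.mem_nhds hpU)).differentiableAt one_ne_zero).hasFDerivAt
  filter_upwards [hx.2.2.eventually (hd.isLittleO.def hε)] with t ht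
  simpa [hp] using ht

end Linearization

/-! ### Lyapunov functions and time reversal -/

section Attraction

variable {f : Plane → Plane} {U : Set Plane} {p : Plane}

/-- Exponential decay of solutions from a quadratic Lyapunov function. -/
theorem norm_sq_le_of_lyapunov {A : Plane →L[ℝ] Plane} {F : Plane → Plane} (hp : F p = 0)
    (B : Plane →L[ℝ] Plane →L[ℝ] ℝ) (hsymm : ∀ v w, B v w = B w v) {m c ε : ℝ} (hm : 0 < m)
    (hcoer : ∀ w, m * ‖w‖ ^ 2 ≤ B w w) (hdecay : ∀ w, B w (A w) ≤ -c * B w w)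
    (hε : 0 < ε) (hsmall : 2 * ‖B‖ * ε ≤ c * m)
    (hF : ∀ x y, ‖F x - F y - A (x - y)‖ ≤ ε * ‖x - y‖) {x : ℝ → Plane}
    (hx : ∀ t ∈ Ici 0, HasDerivWithinAt x (F (x t)) (Ici 0) t) {t : ℝ} (ht : 0 ≤ t) :
    m * ‖x t - p‖ ^ 2 ≤ ‖B‖ * ‖x 0 - p‖ ^ 2 * Real.exp (-c * t) := by
  have hBbound : ∀ v w, B v w ≤ ‖B‖ * ‖v‖ * ‖w‖ := fun v w =>
    (le_abs_self _).trans (B.le_opNorm₂ v w)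
  have hV := le_exp_mul_of_deriv_le (h := fun t => B (x t - p) (x t - p))
    (h' := fun t => 2 * B (x t - p) (F (x t))) (c := -c) (T := 0)
    (fun t ht => by
      have hd := (hx t ht).sub_const p
      have := (B.hasFDerivAt.comp_hasDerivWithinAt t hd).clm_apply hd
      refine this.congr_deriv ?_
      simp only [Function.comp_apply]
      rw [hsymm (F (x t))]; ring)
    -- The linear part contributes at most -2c V to V'. The perturbation contributes at most
    -- 2‖B‖ε‖w‖² ≤ c m‖w‖² ≤ c V, which leaves the rate -c.
    (fun t _ => by
      set w := x t - p
      have h1 := hF (x t) p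
      rw [hp, sub_zero] at h1
      have h2 : B w (F (x t)) = B w (A w) + B w (F (x t) - A w) := by rw [map_sub (B w)]; ring
      have h3 : B w (F (x t) - A w) ≤ ‖B‖ * ‖w‖ * (ε * ‖w‖) :=
        (hBbound _ _).trans (by gcongr)
      have h4 := hdecay w
      have h5 := hcoer w
      have hc0 : 0 ≤ c :=
        nonneg_of_mul_nonneg_left ((by positivity : 0 ≤ 2 * ‖B‖ * ε).trans hsmall) hm
      have h6 := mul_le_mul_of_nonneg_right hsmall (sq_nonneg ‖w‖)
      have h7 := mul_le_mul_of_nonneg_left h5 hc0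
      nlinarith) le_rfl ht
  simp only [sub_zero] at hV
  refine (hcoer _).trans (hV.trans ?_)
  gcongr
  exact (hBbound _ _).trans (by rw [mul_assoc, sq])

theorem isAttracting_of_lyapunov (hU : IsOpen U) (hf : ContDiffOn ℝ 1 f U) (hpU : p ∈ U)
    (hp : f p = 0) (B : Plane →L[ℝ] Plane →L[ℝ] ℝ) (hsymm : ∀ v w, B v w = B w v) {m c : ℝ}
    (hm : 0 < m) (hc : 0 < c) (hcoer : ∀ w, m * ‖w‖ ^ 2 ≤ B w w)
    (hdecay : ∀ w, B w (fderiv ℝ f p w) ≤ -c * B w w) : IsAttracting f U p := by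
  intro η hη
  have hB : 0 < 2 * ‖B‖ + 1 := by positivity
  have hε : 0 < c * m / (2 * ‖B‖ + 1) := by positivity
  obtain ⟨r, hr, hrU, F, K, hK, hFf, hF⟩ := exists_lipschitz_extension hU hf hpU hε
  have hFp : F p = 0 := by rw [hFf (Metric.mem_ball_self hr), hp]
  set ρ := min r η
  have hρ : 0 < ρ := lt_min hr hη
  set M := ‖B‖ / m with hM
  have hM0 : 0 ≤ M := by positivity
  -- Since M < (M + 1)², starting within this radius keeps the solution of F within ρ, where F = f.
  refine ⟨ρ / (M + 1), by positivity, fun x₀ hx₀ => ?_⟩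
  obtain ⟨x, hx0, hx⟩ := exists_solution_Ici_of_lipschitzWith hK hFp x₀
  have hest : ∀ t, 0 ≤ t → ‖x t - p‖ ^ 2 ≤ M * ‖x₀ - p‖ ^ 2 * Real.exp (-c * t) := by
    intro t ht
    have h := norm_sq_le_of_lyapunov hFp B hsymm hm hcoer hdecay hε (by
      rw [mul_div_assoc', div_le_iff₀ hB]
      nlinarith [mul_pos hc hm]) hF hx ht
    rw [hx0] at h
    rw [hM, div_mul_eq_mul_div, div_mul_eq_mul_div, le_div_iff₀ hm]
    linarith
  have hball : ∀ t, 0 ≤ t → ‖x t - p‖ < ρ := by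
    intro t ht
    refine lt_of_pow_lt_pow_left₀ 2 hρ.le ((hest t ht).trans_lt ?_)
    have h1 : Real.exp (-c * t) ≤ 1 := Real.exp_le_one_iff.2 (by nlinarith)
    have h2 : ‖x₀ - p‖ ≤ ρ / (M + 1) := (mem_ball_iff_norm.1 hx₀).le
    calc M * ‖x₀ - p‖ ^ 2 * Real.exp (-c * t) ≤ M * (ρ / (M + 1)) ^ 2 * 1 := by gcongr
      _ = ρ ^ 2 * (M / (M + 1) ^ 2) := by field_simp
      _ < ρ ^ 2 * 1 := by
          gcongr
          rw [div_lt_one (by positivity)]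
          nlinarith
      _ = ρ ^ 2 := mul_one _
  have hsol : IsSolutionOn f U x (Ici 0) := by
    intro t ht
    have hmem : x t ∈ Metric.ball p r :=
      mem_ball_iff_norm.2 ((hball t ht).trans_le (min_le_left _ _))
    refine ⟨hrU hmem, ?_⟩
    rw [← hFf hmem]
    exact hx t ht
  have hlim : Tendsto x atTop (𝓝 p) := by
    rw [tendsto_iff_norm_sub_tendsto_zero]
    have h0 : Tendsto (fun t : ℝ => M * ‖x₀ - p‖ ^ 2 * Real.exp (-c * t)) atTop (𝓝 0) := by
      simpa using (tendsto_exp_neg_mul_sub hc 0).const_mul (M * ‖x₀ - p‖ ^ 2)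
    have h1 : Tendsto (fun t => ‖x t - p‖ ^ 2) atTop (𝓝 0) :=
      tendsto_of_tendsto_of_tendsto_of_le_of_le' tendsto_const_nhds h0
        (Eventually.of_forall fun _ => sq_nonneg _)
        ((eventually_ge_atTop 0).mono fun t ht => hest t ht)
    simpa [Real.sqrt_sq] using h1.sqrt
  refine ⟨⟨x, hx0, hsol⟩, fun y hy0 hy => ?_⟩
  have heq := IsSolutionOn.eqOn_Ici hU hf hy hsol le_rfl (hy0.trans hx0.symm)
  refine ⟨fun t ht => ?_, hlim.congr' ?_⟩
  · rw [heq ht]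
    exact mem_ball_iff_norm.2 ((hball t ht).trans_le (min_le_right _ _))
  · exact (eventually_ge_atTop 0).mono fun t ht => (heq ht).symm

theorem IsAttracting.isRepelling_of_neg (h : IsAttracting (-f) U p) : IsRepelling f U p := by
  intro ε hε
  obtain ⟨δ, hδ, H⟩ := h ε hε
  refine ⟨δ, hδ, fun x₀ hx₀ => ?_⟩
  obtain ⟨⟨x, hx0, hx⟩, hall⟩ := H x₀ hx₀
  refine ⟨⟨fun t => x (-t), by simpa using hx0, hx.reverse_of_Ici⟩, fun y hy0 hy => ?_⟩
  obtain ⟨h1, h2⟩ := hall _ (by simpa using hy0) hy.reverse_of_Iic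
  refine ⟨fun t ht => by simpa using h1 (-t) (neg_nonneg.2 ht), ?_⟩
  simpa [Function.comp_def] using h2.comp tendsto_neg_atBot_atTop

theorem IsOutgoing.reverse {x : ℝ → Plane} (h : IsOutgoing f U p x) :
    IsIncoming (-f) U p (fun t => x (-t)) :=
  ⟨h.1.reverse_of_Iic, by simpa using h.2.1, h.2.2.comp tendsto_neg_atTop_atBot⟩

theorem IsIncoming.reverse {x : ℝ → Plane} (h : IsIncoming (-f) U p x) :
    IsOutgoing f U p (fun t => x (-t)) :=
  ⟨h.1.reverse_of_Ici, by simpa using h.2.1, h.2.2.comp tendsto_neg_atBot_atTop⟩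

end Attraction

/-! ### Nodes -/

section Node

variable {f : Plane → Plane} {U : Set Plane} {p : Plane}

theorem isAttracting_of_eigenFrame (hU : IsOpen U) (hf : ContDiffOn ℝ 1 f U) (hpU : p ∈ U)
    (hp : f p = 0) {a b : ℝ} (S : EigenFrame (fderiv ℝ f p) a b) (hab : b < a) (ha : a < 0) :
    IsAttracting f U p := by
  -- The sum of squares of the eigencoordinates. The 1/2 comes from (s + t)² ≤ 2(s² + t²), and the
  -- rate from the slower eigenvalue a.
  refine isAttracting_of_lyapunov hU hf hpU hp (S.l₁.smulRight S.l₁ + S.l₂.smulRight S.l₂)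
    (m := 1 / 2) (c := -a) (fun v w => ?_) (by norm_num) (by linarith) (fun w => ?_) (fun w => ?_)
  · simp; ring
  · have h := pow_le_pow_left₀ (norm_nonneg w) (S.norm_le w) 2
    simp only [add_apply, ContinuousLinearMap.smulRight_apply,
      smul_apply, smul_eq_mul]
    nlinarith [sq_nonneg (|S.l₁ w| - |S.l₂ w|), sq_abs (S.l₁ w), sq_abs (S.l₂ w)]
  · simp only [add_apply, ContinuousLinearMap.smulRight_apply,
      smul_apply, smul_eq_mul, S.l₁_map, S.l₂_map]
    nlinarith [mul_nonneg (sub_pos.2 hab).le (sq_nonneg (S.l₂ w))]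

theorem IsIncoming.exists_tendsto_direction_velocity (hU : IsOpen U) (hf : ContDiffOn ℝ 1 f U)
    (hpU : p ∈ U) {a b : ℝ} (S : EigenFrame (fderiv ℝ f p) a b) (hab : b < a) {x : ℝ → Plane}
    (hx : IsIncoming f U p x) :
    ∃ v : Plane, ‖v‖ = 1 ∧ Tendsto (fun t => direction (f (x t))) atTop (𝓝 v) :=
  S.exists_tendsto_direction hab (fun _ ht => hx.hasDerivWithinAt_velocity hU hf ht)
    (fun _ ht => hx.velocity_ne_zero hU hf ht) fun _ hε => hx.eventually_velocity_le hU hf hpU hε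

theorem fderiv_pi_neg (f : Plane → Plane) (p : Plane) : fderiv ℝ (-f) p = -fderiv ℝ f p :=
  fderiv_neg

theorem isNode_of_eigenFrame (hU : IsOpen U) (hf : ContDiffOn ℝ 1 f U) (hpU : p ∈ U)
    (hp : f p = 0) {a b : ℝ} (S : EigenFrame (fderiv ℝ f p) a b) (hab : b < a)
    (hpos : 0 < a * b) : IsNode f U p := by
  rcases lt_or_ge a 0 with ha | ha
  · exact Or.inl ⟨isAttracting_of_eigenFrame hU hf hpU hp S hab ha,
      fun x hx => hx.exists_tendsto_direction_velocity hU hf hpU S hab⟩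
  · have hb : 0 < b := pos_of_mul_pos_right hpos ha
    -- Negation reverses the order of the eigenvalues; swapping puts the larger one first again.
    have S' : EigenFrame (fderiv ℝ (-f) p) (-b) (-a) := by
      rw [fderiv_pi_neg]; exact S.swap.neg
    have hab' : -a < -b := neg_lt_neg hab
    refine Or.inr ⟨(isAttracting_of_eigenFrame hU hf.neg hpU (by simp [hp]) S' hab'
      (neg_neg_of_pos hb)).isRepelling_of_neg, fun x hx => ?_⟩
    obtain ⟨v, hv, hlim⟩ :=
      hx.reverse.exists_tendsto_direction_velocity hU hf.neg hpU S' hab'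
    refine ⟨-v, by rwa [norm_neg], ?_⟩
    simpa [Function.comp_def, direction_neg] using (hlim.comp tendsto_neg_atBot_atTop).neg

end Node

/-! ### Angle functions and definite quadratic forms -/

section Angle

theorem norm_unitAt (θ : ℝ) : ‖unitAt θ‖ = 1 := by
  rw [EuclideanSpace.norm_eq, Fin.sum_univ_two]
  simp [unitAt]

theorem direction_unitAt (θ : ℝ) : direction (unitAt θ) = unitAt θ := by
  simp [direction, norm_unitAt]

theorem neg_unitAt (θ : ℝ) : -unitAt θ = unitAt (θ + Real.pi) := by
  ext i; fin_cases i <;> simp [unitAt]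

/-- A plane vector as a complex number. -/
noncomputable def toComplex : Plane →L[ℝ] ℂ :=
  Complex.ofRealCLM.comp (EuclideanSpace.proj 0) +
    (Complex.ofRealCLM.comp (EuclideanSpace.proj 1)).smulRight Complex.I

theorem toComplex_re (w : Plane) : (toComplex w).re = w 0 := by simp [toComplex]

theorem toComplex_im (w : Plane) : (toComplex w).im = w 1 := by simp [toComplex]

theorem normSq_toComplex (w : Plane) : Complex.normSq (toComplex w) = ‖w‖ ^ 2 := by
  rw [Complex.normSq_apply, toComplex_re, toComplex_im, EuclideanSpace.real_norm_sq_eq,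
    Fin.sum_univ_two]
  ring

theorem toComplex_ne_zero {w : Plane} (hw : w ≠ 0) : toComplex w ≠ 0 := by
  rw [← Complex.normSq_pos, normSq_toComplex]
  positivity

/-- A nowhere vanishing `C¹` curve in the plane has a differentiable angle function. -/
theorem exists_angle {v v' : ℝ → Plane}
    (hv : ∀ t ∈ Ici 0, HasDerivWithinAt v (v' t) (Ici 0) t) (hv' : ContinuousOn v' (Ici 0))
    (hv0 : ∀ t ∈ Ici 0, v t ≠ 0) :
    ∃ θ : ℝ → ℝ, (∀ t ≥ 0, direction (v t) = unitAt (θ t)) ∧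
      ∀ t ∈ Ici 0, HasDerivWithinAt θ ((v t 0 * v' t 1 - v t 1 * v' t 0) / ‖v t‖ ^ 2)
        (Ici 0) t := by
  set z : ℝ → ℂ := fun t => toComplex (v t) with hz
  set z' : ℝ → ℂ := fun t => toComplex (v' t) with hz'
  have hz0 : ∀ t ∈ Ici 0, z t ≠ 0 := fun t ht => toComplex_ne_zero (hv0 t ht)
  have hzd : ∀ t ∈ Ici 0, HasDerivWithinAt z (z' t) (Ici 0) t := fun t ht =>
    toComplex.hasFDerivAt.comp_hasDerivWithinAt t (hv t ht)
  have hzc : ContinuousOn z (Ici 0) := fun t ht => (hzd t ht).continuousWithinAt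
  have hzc' : ContinuousOn z' (Ici 0) := toComplex.continuous.comp_continuousOn hv'
  -- The logarithmic derivative, frozen at its value at 0 for negative t so that it is continuous on
  -- the line. Its integral G is a logarithm of z/z(0), and the imaginary part of G is the change of
  -- angle.
  set g : ℝ → ℂ := fun t => z' (max t 0) / z (max t 0) with hg
  have hgc : Continuous g :=
    (hzc'.div hzc hz0).comp_continuous (continuous_id.max continuous_const)
      fun t => mem_Ici.2 (le_max_right _ _)
  have hgt : ∀ t ∈ Ici (0 : ℝ), g t = z' t / z t := fun t ht => by
    simp only [hg, max_eq_left (mem_Ici.1 ht)]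
  set G : ℝ → ℂ := fun t => ∫ s in (0 : ℝ)..t, g s with hG
  have hGd : ∀ t, HasDerivAt G (g t) t := fun t => (hgc.integral_hasStrictDerivAt 0 t).hasDerivAt
  have hconst : ∀ t ∈ Ici (0 : ℝ), z t * Complex.exp (-G t) = z 0 := by
    intro t ht
    have hd : ∀ s ∈ Ici (0 : ℝ), HasDerivWithinAt (fun s => z s * Complex.exp (-G s)) 0
        (Ici 0) s := fun s hs => by
      refine ((hzd s hs).mul (hGd s).neg.cexp.hasDerivWithinAt).congr_deriv ?_
      rw [hgt s hs]
      have := hz0 s hs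
      field_simp
      ring
    have := (convex_Ici (0 : ℝ)).norm_image_sub_le_of_norm_hasDerivWithin_le (C := 0) hd
      (fun s _ => by simp) self_mem_Ici ht
    rw [zero_mul, norm_le_zero_iff, sub_eq_zero] at this
    rw [this]
    simp [hG]
  refine ⟨fun t => Complex.arg (z 0) + (G t).im, fun t ht => ?_, fun t ht => ?_⟩
  · set θ := Complex.arg (z 0) + (G t).im with hθ
    have hpos : 0 < ‖z 0‖ * Real.exp (G t).re :=
      mul_pos (norm_pos_iff.2 (hz0 0 self_mem_Ici)) (Real.exp_pos _)
    have hzt : z t = ((‖z 0‖ * Real.exp (G t).re : ℝ) : ℂ) * Complex.exp (θ * Complex.I) := by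
      have h1 : z t = z 0 * Complex.exp (G t) := by
        rw [← hconst t ht, mul_assoc, ← Complex.exp_add]; simp
      have h2 : Complex.exp (G t) =
          Real.exp (G t).re * Complex.exp ((G t).im * Complex.I) := by
        rw [Complex.ofReal_exp, ← Complex.exp_add, Complex.re_add_im]
      have h3 := Complex.norm_mul_exp_arg_mul_I (z 0)
      rw [h1, h2, hθ]
      simp only [Complex.ofReal_mul, Complex.ofReal_add, add_mul, Complex.exp_add]
      linear_combination
        (-(Real.exp (G t).re * Complex.exp ((G t).im * Complex.I))) * h3
    have hvt : v t = (‖z 0‖ * Real.exp (G t).re) • unitAt θ := by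
      ext i
      fin_cases i
      · have := congrArg Complex.re hzt
        rw [Complex.re_ofReal_mul, Complex.exp_ofReal_mul_I_re, hz] at this
        simpa [toComplex_re, unitAt] using this
      · have := congrArg Complex.im hzt
        rw [Complex.im_ofReal_mul, Complex.exp_ofReal_mul_I_im, hz] at this
        simpa [toComplex_im, unitAt] using this
    rw [hvt, direction_smul hpos, direction_unitAt]
  · have h1 : HasDerivAt (fun t => (G t).im) (g t).im t :=
      Complex.imCLM.hasFDerivAt.comp_hasDerivAt t (hGd t)
    refine (h1.const_add _).hasDerivWithinAt.congr_deriv ?_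
    rw [hgt t ht, Complex.div_im, normSq_toComplex]
    simp only [hz, hz', toComplex_re, toComplex_im]
    ring

theorem tendsto_atTop_of_deriv_ge {θ θ' : ℝ → ℝ} {k : ℝ} (hk : 0 < k)
    (hd : ∀ t ∈ Ici 0, HasDerivWithinAt θ (θ' t) (Ici 0) t)
    (hge : ∀ᶠ t in atTop, k ≤ θ' t) : Tendsto θ atTop atTop := by
  obtain ⟨T, hT⟩ := eventually_atTop.1 hge
  set T₀ := max T 0
  have hsub : Ici T₀ ⊆ Ici (0 : ℝ) := Ici_subset_Ici.2 (le_max_right _ _)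
  have hbound : ∀ t, T₀ ≤ t → θ T₀ - k * T₀ + k * t ≤ θ t := fun t ht => by
    have := exp_mul_le_of_deriv_ge (h := fun t => θ t - k * t) (h' := fun t => θ' t - k)
      (c := 0) (T := T₀)
      (fun t ht => (((hd t (hsub ht)).mono hsub).sub
        ((hasDerivWithinAt_id t _).const_mul k)).congr_deriv (by simp))
      (fun t ht => by linarith [hT t ((le_max_left _ _).trans ht)]) le_rfl ht
    simp only [zero_mul, Real.exp_zero, mul_one] at this
    linarith
  exact tendsto_atTop_mono' _ ((eventually_ge_atTop T₀).mono hbound)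
    (tendsto_atTop_add_const_left _ _ (tendsto_id.const_mul_atTop hk))

theorem abs_cross_le (v w : Plane) : |v 0 * w 1 - v 1 * w 0| ≤ 2 * (‖v‖ * ‖w‖) := by
  have h : ∀ (u : Plane) i, |u i| ≤ ‖u‖ := fun u i => PiLp.norm_apply_le u i
  calc |v 0 * w 1 - v 1 * w 0| ≤ |v 0 * w 1| + |v 1 * w 0| := abs_sub _ _
    _ ≤ ‖v‖ * ‖w‖ + ‖v‖ * ‖w‖ := by
        rw [abs_mul, abs_mul]
        gcongr <;> apply h
    _ = _ := by ring

/-- Determinant over trace is a lower bound for the smaller eigenvalue of the form. With m this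
quotient, (P - m)(R - m) - h² = m², so completing the square leaves a nonnegative remainder. -/
theorem quadratic_form_ge {P R h : ℝ} (hP : 0 < P) (hR : 0 < R) (hdet : h ^ 2 < P * R)
    (x y : ℝ) :
    (P * R - h ^ 2) / (P + R) * (x ^ 2 + y ^ 2) ≤ P * x ^ 2 - 2 * h * x * y + R * y ^ 2 := by
  set m := (P * R - h ^ 2) / (P + R) with hm
  have hm1 : m * (P + R) = P * R - h ^ 2 := div_mul_cancel₀ _ (by positivity)
  have hmP : 0 < P - m := by
    rw [sub_pos, hm, div_lt_iff₀ (by positivity)]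
    nlinarith [sq_nonneg h, mul_pos hP hP]
  have h1 : 0 ≤ (P - m) * (P * x ^ 2 - 2 * h * x * y + R * y ^ 2 - m * (x ^ 2 + y ^ 2)) := by
    have e : (P - m) * (P * x ^ 2 - 2 * h * x * y + R * y ^ 2 - m * (x ^ 2 + y ^ 2)) =
        ((P - m) * x - h * y) ^ 2 + m ^ 2 * y ^ 2 := by
      linear_combination (-y ^ 2) * hm1
    rw [e]; positivity
  linarith [nonneg_of_mul_nonneg_right h1 hmP]

end Angle

/-! ### Foci -/

section Focus

variable {f : Plane → Plane} {U : Set Plane} {p : Plane}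

theorem norm_sq_plane (w : Plane) : ‖w‖ ^ 2 = w 0 ^ 2 + w 1 ^ 2 := by
  rw [EuclideanSpace.real_norm_sq_eq, Fin.sum_univ_two]

/-- The traceless part N = A - (tr A / 2) I satisfies N² = -ω² I with -ω² = h² + βγ. For B(v, w) =
⟨Nv, Nw⟩ + ω²⟨v, w⟩ this gives B(w, Nw) = 0, hence B(w, Aw) = (tr A / 2) B(w, w) exactly. -/
theorem isAttracting_of_neg_discrim (hU : IsOpen U) (hf : ContDiffOn ℝ 1 f U) (hpU : p ∈ U)
    (hp : f p = 0) {α β γ δ : ℝ} (h0 : ∀ w, fderiv ℝ f p w 0 = α * w 0 + β * w 1)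
    (h1 : ∀ w, fderiv ℝ f p w 1 = γ * w 0 + δ * w 1)
    (hdisc : ((α - δ) / 2) ^ 2 + β * γ < 0) (htr : α + δ < 0) : IsAttracting f U p := by
  set e : Fin 2 → Plane →L[ℝ] ℝ := fun i => EuclideanSpace.proj i with he
  have hev : ∀ i (w : Plane), e i w = w i := fun i w => rfl
  set h := (α - δ) / 2 with hh
  set n₀ : Plane →L[ℝ] ℝ := h • e 0 + β • e 1 with hn₀
  set n₁ : Plane →L[ℝ] ℝ := γ • e 0 - h • e 1 with hn₁
  refine isAttracting_of_lyapunov hU hf hpU hp (n₀.smulRight n₀ + n₁.smulRight n₁ -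
    (h ^ 2 + β * γ) • ((e 0).smulRight (e 0) + (e 1).smulRight (e 1)))
    (m := -(h ^ 2 + β * γ)) (c := -((α + δ) / 2)) (fun v w => ?_) (by linarith) (by linarith)
    (fun w => ?_) (fun w => ?_)
  · simp only [hn₀, hn₁, add_apply, sub_apply, smul_apply,
      ContinuousLinearMap.smulRight_apply, smul_eq_mul, hev]
    ring
  · simp only [hn₀, hn₁, add_apply, sub_apply, smul_apply,
      ContinuousLinearMap.smulRight_apply, smul_eq_mul, hev, norm_sq_plane]
    nlinarith [sq_nonneg (h * w 0 + β * w 1), sq_nonneg (γ * w 0 - h * w 1)]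
  · simp only [hn₀, hn₁, add_apply, sub_apply, smul_apply,
      ContinuousLinearMap.smulRight_apply, smul_eq_mul, hev, h0, h1, hh]
    exact le_of_eq (by ring)

/-- If the linearization rotates all vectors in the direction `σ`, then so does the velocity
along incoming trajectories. -/
theorem IsIncoming.exists_angle_velocity (hU : IsOpen U) (hf : ContDiffOn ℝ 1 f U)
    (hpU : p ∈ U) {m σ : ℝ} (hm : 0 < m) (hσ : |σ| = 1)
    (hrot : ∀ w : Plane, m * ‖w‖ ^ 2 ≤
      σ * (w 0 * fderiv ℝ f p w 1 - w 1 * fderiv ℝ f p w 0))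
    {x : ℝ → Plane} (hx : IsIncoming f U p x) :
    ∃ θ : ℝ → ℝ, ContinuousOn θ (Ici 0) ∧ (∀ t ≥ 0, direction (f (x t)) = unitAt (θ t)) ∧
      Tendsto (fun t => σ * θ t) atTop atTop := by
  have hxU : MapsTo x (Ici 0) U := fun t ht => (hx.1 t ht).1
  have hfx : ContinuousOn (fun t => f (x t)) (Ici 0) :=
    hf.continuousOn.comp hx.1.continuousOn hxU
  have hfd : ContinuousOn (fun t => fderiv ℝ f (x t)) (Ici 0) :=
    (hf.continuousOn_fderiv_of_isOpen hU le_rfl).comp hx.1.continuousOn hxU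
  obtain ⟨θ, hθ, hθd⟩ := exists_angle (fun t ht => hx.hasDerivWithinAt_velocity hU hf ht)
    (hfd.clm_apply hfx) (fun t ht => hx.velocity_ne_zero hU hf ht)
  refine ⟨θ, fun t ht => (hθd t ht).continuousWithinAt, hθ, ?_⟩
  refine tendsto_atTop_of_deriv_ge (half_pos hm) (fun t ht => (hθd t ht).const_mul σ) ?_
  -- The cross product bound has a factor 2, so m/4 costs half of the rotation rate m and leaves
  -- m/2.
  filter_upwards [hx.eventually_velocity_le hU hf hpU (ε := m / 4) (by positivity),
    eventually_ge_atTop 0] with t ht ht0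
  set v := f (x t)
  set A := fderiv ℝ f p
  set v' := fderiv ℝ f (x t) v
  have hv : 0 < ‖v‖ := norm_pos_iff.2 (hx.velocity_ne_zero hU hf ht0)
  have h1 := hrot v
  have h2 : -(2 * (‖v‖ * (m / 4 * ‖v‖))) ≤ σ * (v 0 * (v' - A v) 1 - v 1 * (v' - A v) 0) := by
    refine (neg_le_neg ?_).trans (neg_abs_le _)
    rw [abs_mul, hσ, one_mul]
    exact (abs_cross_le _ _).trans (by gcongr)
  simp only [PiLp.sub_apply] at h2
  rw [mul_div_assoc', le_div_iff₀ (by positivity)]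
  nlinarith

/-- The cross product of w and A w is γ w₀² - (α - δ) w₀ w₁ - β w₁². The discriminant condition
makes it definite, and the sign of γ is the sense of rotation. -/
theorem IsIncoming.exists_angle_velocity_of_neg_discrim (hU : IsOpen U)
    (hf : ContDiffOn ℝ 1 f U) (hpU : p ∈ U)
    {α β γ δ : ℝ} (h0 : ∀ w, fderiv ℝ f p w 0 = α * w 0 + β * w 1)
    (h1 : ∀ w, fderiv ℝ f p w 1 = γ * w 0 + δ * w 1)
    (hdisc : ((α - δ) / 2) ^ 2 + β * γ < 0) {x : ℝ → Plane} (hx : IsIncoming f U p x) :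
    ∃ θ : ℝ → ℝ, ContinuousOn θ (Ici 0) ∧ (∀ t ≥ 0, direction (f (x t)) = unitAt (θ t)) ∧
      (Tendsto θ atTop atTop ∨ Tendsto θ atTop atBot) := by
  have hγ : γ ≠ 0 := fun h => by rw [h] at hdisc; nlinarith [sq_nonneg ((α - δ) / 2)]
  rcases lt_or_gt_of_ne hγ with hγ | hγ
  · have hβ : 0 < β := by nlinarith [sq_nonneg ((α - δ) / 2)]
    obtain ⟨θ, hc, hdir, hlim⟩ := hx.exists_angle_velocity hU hf hpU
      (m := (-γ * β - (-((α - δ) / 2)) ^ 2) / (-γ + β)) (σ := -1)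
      (div_pos (by nlinarith) (by linarith)) (by simp) fun w => by
        rw [norm_sq_plane, h0, h1]
        refine (quadratic_form_ge (neg_pos.2 hγ) hβ (by nlinarith) _ _).trans
          (le_of_eq (by ring))
    refine ⟨θ, hc, hdir, Or.inr ?_⟩
    simpa [Function.comp_def] using tendsto_neg_atTop_atBot.comp hlim
  · have hβ : 0 < -β := by nlinarith [sq_nonneg ((α - δ) / 2)]
    obtain ⟨θ, hc, hdir, hlim⟩ := hx.exists_angle_velocity hU hf hpU
      (m := (γ * -β - ((α - δ) / 2) ^ 2) / (γ + -β)) (σ := 1)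
      (div_pos (by nlinarith) (by linarith)) (by simp) fun w => by
        rw [norm_sq_plane, h0, h1]
        refine (quadratic_form_ge hγ hβ (by nlinarith) _ _).trans
          (le_of_eq (by ring))
    exact ⟨θ, hc, hdir, Or.inl (by simpa using hlim)⟩

theorem isFocus_of_neg_discrim (hU : IsOpen U) (hf : ContDiffOn ℝ 1 f U) (hpU : p ∈ U)
    (hp : f p = 0) {α β γ δ : ℝ} (h0 : ∀ w, fderiv ℝ f p w 0 = α * w 0 + β * w 1)
    (h1 : ∀ w, fderiv ℝ f p w 1 = γ * w 0 + δ * w 1)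
    (hdisc : ((α - δ) / 2) ^ 2 + β * γ < 0) (htr : α + δ ≠ 0) : IsFocus f U p := by
  rcases lt_or_gt_of_ne htr with htr | htr
  · exact Or.inl ⟨isAttracting_of_neg_discrim hU hf hpU hp h0 h1 hdisc htr,
      fun x hx => hx.exists_angle_velocity_of_neg_discrim hU hf hpU h0 h1 hdisc⟩
  · have h0' : ∀ w, fderiv ℝ (-f) p w 0 = -α * w 0 + -β * w 1 := fun w => by
      rw [fderiv_pi_neg, neg_apply, PiLp.neg_apply, h0]; ring
    have h1' : ∀ w, fderiv ℝ (-f) p w 1 = -γ * w 0 + -δ * w 1 := fun w => by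
      rw [fderiv_pi_neg, neg_apply, PiLp.neg_apply, h1]; ring
    have hdisc' : ((-α - -δ) / 2) ^ 2 + -β * -γ < 0 := by
      convert hdisc using 1; ring
    refine Or.inr ⟨(isAttracting_of_neg_discrim hU hf.neg hpU (by simp [hp]) h0' h1' hdisc'
      (by linarith)).isRepelling_of_neg, fun x hx => ?_⟩
    obtain ⟨θ, hc, hdir, hlim⟩ :=
      hx.reverse.exists_angle_velocity_of_neg_discrim hU hf.neg hpU h0' h1' hdisc'
    -- The half turn compensates for the sign of -f.
    refine ⟨fun t => θ (-t) + Real.pi, ?_, fun t ht => ?_, ?_⟩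
    · exact (hc.comp continuousOn_neg fun t ht => neg_nonneg.2 (mem_Iic.1 ht)).add
        continuousOn_const
    · have := hdir (-t) (neg_nonneg.2 ht)
      simp only [neg_neg, direction_neg] at this
      simp only [← neg_unitAt, ← this, neg_neg]
    · exact hlim.imp
        (fun h => tendsto_atTop_add_const_right _ _ (h.comp tendsto_neg_atBot_atTop))
        (fun h => tendsto_atBot_add_const_right _ _ (h.comp tendsto_neg_atBot_atTop))

end Focus

/-! ### Invariant cones of a hyperbolic map -/

theorem saddle_form_deriv_bound {y y' z z' a b ε : ℝ} (hε : 0 ≤ ε) (ha : 4 * ε ≤ a)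
    (hb : 4 * ε ≤ -b) (hy : |y' - a * y| ≤ ε * (|y| + |z|))
    (hz : |z' - b * z| ≤ ε * (|y| + |z|)) :
    4 * ε * (y ^ 2 + z ^ 2) ≤ 2 * y * y' - 2 * z * z' := by
  have h1 : -(|y| * (ε * (|y| + |z|))) ≤ y * (y' - a * y) :=
    (neg_le_neg (by rw [abs_mul]; gcongr)).trans (neg_abs_le _)
  have h2 : z * (z' - b * z) ≤ |z| * (ε * (|y| + |z|)) :=
    (le_abs_self _).trans (by rw [abs_mul]; gcongr)
  -- The errors cost at most 2ε(|y| + |z|)² ≤ 4ε(y² + z²), half of the 8ε(y² + z²) supplied by the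
  -- linear part.
  have h3 := mul_nonneg hε (sq_nonneg (|y| - |z|))
  have h4 := mul_le_mul_of_nonneg_right ha (sq_nonneg y)
  have h5 := mul_le_mul_of_nonneg_right hb (sq_nonneg z)
  nlinarith [sq_abs y, sq_abs z]

theorem stable_coord_deriv_bound {y z z' b ε : ℝ} (hε : 0 ≤ ε) (hb : 4 * ε ≤ -b)
    (hyz : |y| ≤ |z|) (hz : |z' - b * z| ≤ ε * (|y| + |z|)) : 2 * z * z' ≤ b * z ^ 2 := by
  have h2 : z * (z' - b * z) ≤ |z| * (ε * (|z| + |z|)) :=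
    (le_abs_self _).trans (by
      rw [abs_mul]
      exact mul_le_mul_of_nonneg_left (hz.trans (by gcongr)) (abs_nonneg _))
  have h5 := mul_le_mul_of_nonneg_right hb (sq_nonneg z)
  nlinarith [sq_abs z]

namespace EigenFrame

variable {A : Plane →L[ℝ] Plane} {a b : ℝ}

/-- The frame with the second eigenvector reversed. -/
def flip₂ (S : EigenFrame A a b) : EigenFrame A a b := S.swap.flip.swap

/-- The relative size of perturbations of a hyperbolic map which keep its cones invariant. -/
noncomputable def tolerance (S : EigenFrame A a b) : ℝ :=
  min a (-b) / 4 / (‖S.l₁‖ + ‖S.l₂‖ + 1)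

theorem tolerance_pos (S : EigenFrame A a b) (ha : 0 < a) (hb : b < 0) : 0 < S.tolerance :=
  div_pos (div_pos (lt_min ha (neg_pos.2 hb)) (by norm_num)) (by positivity)

theorem tolerance_flip₂ (S : EigenFrame A a b) : S.flip₂.tolerance = S.tolerance := by
  simp [tolerance, flip₂, flip, swap]

theorem tolerance_flip (S : EigenFrame A a b) : S.flip.tolerance = S.tolerance := by
  simp [tolerance, flip]

section Cone

variable (S : EigenFrame A a b) (ha : 0 < a) (hb : b < 0) {w w' : ℝ → Plane}
  (hw : ∀ t ∈ Ici 0, HasDerivWithinAt w (w' t) (Ici 0) t)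
  (hsmall : ∀ t ∈ Ici 0, ‖w' t - A (w t)‖ ≤ S.tolerance * ‖w t‖)

/-- The difference of squares of the unstable and the stable coordinate. -/
noncomputable def form (S : EigenFrame A a b) (w : Plane) : ℝ := S.l₁ w ^ 2 - S.l₂ w ^ 2

theorem form_neg_iff (w : Plane) : S.form w < 0 ↔ |S.l₁ w| < |S.l₂ w| := by
  rw [form, sub_neg, sq_lt_sq]

theorem form_pos_iff (w : Plane) : 0 < S.form w ↔ |S.l₂ w| < |S.l₁ w| := by
  rw [form, sub_pos, sq_lt_sq]

include ha hb hw hsmall in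
theorem form_hasDeriv {t : ℝ} (ht : t ∈ Ici (0 : ℝ)) :
    ∃ q', HasDerivWithinAt (fun t => S.form (w t)) q' (Ici 0) t ∧
      min a (-b) * (S.l₁ (w t) ^ 2 + S.l₂ (w t) ^ 2) ≤ q' := by
  have h1 := (S.l₁.hasFDerivAt.comp_hasDerivWithinAt t (hw t ht)).pow 2
  have h2 := (S.l₂.hasFDerivAt.comp_hasDerivWithinAt t (hw t ht)).pow 2
  refine ⟨2 * S.l₁ (w t) * S.l₁ (w' t) - 2 * S.l₂ (w t) * S.l₂ (w' t),
    (h1.sub h2).congr_deriv (by simp), ?_⟩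
  have hm : 0 ≤ min a (-b) / 4 := div_nonneg (le_min ha.le (neg_pos.2 hb).le) (by norm_num)
  obtain ⟨h3, h4⟩ := S.coord_bounds hm (hsmall t ht)
  have := saddle_form_deriv_bound hm (by linarith [min_le_left a (-b)])
    (by linarith [min_le_right a (-b)]) h3 h4
  linarith

include ha hb hw hsmall in
theorem monotoneOn_form : MonotoneOn (fun t => S.form (w t)) (Ici 0) := by
  choose! q' hq hq' using fun t (ht : t ∈ Ici (0 : ℝ)) => S.form_hasDeriv ha hb hw hsmall ht
  refine monotoneOn_of_hasDerivWithinAt_nonneg (convex_Ici 0) (f' := q')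
    (fun t ht => (hq t ht).continuousWithinAt)
    (fun t ht => (hq t (interior_subset ht)).mono interior_subset)
    (fun t ht => le_trans ?_ (hq' t (interior_subset ht)))
  have : 0 < min a (-b) := lt_min ha (neg_pos.2 hb)
  positivity

include ha hb hw hsmall in
/-- A solution in the unstable cone does not tend to zero. -/
theorem eq_zero_of_tendsto_zero (hlim : Tendsto w atTop (𝓝 0)) {s : ℝ} (hs : 0 ≤ s)
    (hqs : 0 ≤ S.form (w s)) : w s = 0 := by
  have hmono := S.monotoneOn_form ha hb hw hsmall
  have hqc : Continuous S.form := (S.l₁.continuous.pow 2).sub (S.l₂.continuous.pow 2)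
  have hqlim : Tendsto (fun t => S.form (w t)) atTop (𝓝 0) := by
    have := (hqc.tendsto 0).comp hlim
    simpa [form, Function.comp_def] using this
  -- A nondecreasing function with limit 0 that is nonnegative at s vanishes from s on. Its
  -- derivative at s is then 0, while it dominates a positive multiple of the sum of squared
  -- coordinates.
  have hzero : ∀ t ∈ Ici s, S.form (w t) = 0 := by
    intro t ht
    have ht0 : (0 : ℝ) ≤ t := hs.trans ht
    refine le_antisymm (ge_of_tendsto hqlim ((eventually_ge_atTop t).mono fun u hu =>
      hmono ht0 (ht0.trans hu) hu)) (hqs.trans (hmono hs ht0 ht))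
  obtain ⟨q', hq, hq'⟩ := S.form_hasDeriv ha hb hw hsmall hs
  have hq0 : q' = 0 := (uniqueDiffOn_Ici s s self_mem_Ici).eq_deriv _
    (hq.mono (Ici_subset_Ici.2 hs))
    ((hasDerivWithinAt_const s (Ici s) (0 : ℝ)).congr hzero (hzero s self_mem_Ici))
  have hm : 0 < min a (-b) := lt_min ha (neg_pos.2 hb)
  by_contra hne
  have hpos : 0 < S.l₁ (w s) ^ 2 + S.l₂ (w s) ^ 2 := by
    rcases S.ne_zero hne with h | h <;> positivity
  have := mul_pos hm hpos
  linarith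

include ha hb hw hsmall in
-- The form stays positive, which excludes a zero of the unstable coordinate; a curve therefore
-- cannot cross between the two halves of the unstable cone.
theorem l₁_pos_of_mem_cone {s t : ℝ} (hs : 0 ≤ s) (hst : s ≤ t)
    (hcone : |S.l₂ (w s)| < S.l₁ (w s)) : 0 < S.l₁ (w t) := by
  have hmono := S.monotoneOn_form ha hb hw hsmall
  have hq : ∀ u ∈ Icc s t, S.l₁ (w u) ≠ 0 := by
    intro u hu h0
    have h1 : 0 < S.form (w u) :=
      ((S.form_pos_iff _).2 (hcone.trans_le (le_abs_self _))).trans_le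
        (hmono hs (hs.trans hu.1) hu.1)
    rw [form_pos_iff, h0, abs_zero] at h1
    exact absurd (abs_nonneg _) (not_le.2 h1)
  have hc : ContinuousOn (fun u => S.l₁ (w u)) (Icc s t) :=
    S.l₁.continuous.comp_continuousOn fun u hu =>
      ((hw u (hs.trans hu.1)).continuousWithinAt).mono fun v hv => hs.trans hv.1
  by_contra! hle
  obtain ⟨u, hu, hu0⟩ := intermediate_value_Icc' hst hc
    ⟨hle, ((abs_nonneg _).trans_lt hcone).le⟩
  exact hq u hu hu0

end Cone

end EigenFrame

/-! ### Incoming trajectories of a saddle -/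

section StableManifold

variable {f : Plane → Plane} {U : Set Plane} {p : Plane} {a b : ℝ}

/-- Shooting: fix the stable coordinate ρ and vary the unstable one, ξ. The values of ξ whose
solutions enter the positive half of the unstable cone form an open set, and so do those for the
negative half. The sets are disjoint and contain |ρ| + 1 and -(|ρ| + 1), so by connectedness of ℝ
some ξ lies in neither. -/
theorem exists_solution_in_stable_cone {A : Plane →L[ℝ] Plane} (S : EigenFrame A a b)
    (ha : 0 < a) (hb : b < 0) {F : Plane → Plane} {K : NNReal} (hK : LipschitzWith K F)
    (hFp : F p = 0) (hF : ∀ x y, ‖F x - F y - A (x - y)‖ ≤ S.tolerance * ‖x - y‖) (ρ : ℝ) :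
    ∃ x : ℝ → Plane, S.l₂ (x 0 - p) = ρ ∧
      (∀ t ∈ Ici 0, HasDerivWithinAt x (F (x t)) (Ici 0) t) ∧
      ∀ t ∈ Ici 0, |S.l₁ (x t - p)| ≤ |S.l₂ (x t - p)| := by
  choose x hx0 hx using fun ξ : ℝ =>
    exists_solution_Ici_of_lipschitzWith hK hFp (p + ξ • S.e₁ + ρ • S.e₂)
  have hw : ∀ ξ, ∀ t ∈ Ici 0,
      HasDerivWithinAt (fun t => x ξ t - p) (F (x ξ t)) (Ici 0) t :=
    fun ξ t ht => (hx ξ t ht).sub_const p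
  have hsmall : ∀ ξ, ∀ t ∈ Ici (0 : ℝ),
      ‖F (x ξ t) - A (x ξ t - p)‖ ≤ S.tolerance * ‖x ξ t - p‖ := fun ξ t _ => by
    simpa [hFp] using hF (x ξ t) p
  have hinit : ∀ ξ, x ξ 0 - p = ξ • S.e₁ + ρ • S.e₂ := fun ξ => by rw [hx0]; abel
  have hy0 : ∀ ξ, S.l₁ (x ξ 0 - p) = ξ := fun ξ => by
    rw [hinit]; simp [S.l₁_e₁, S.l₁_e₂]
  have hz0 : ∀ ξ, S.l₂ (x ξ 0 - p) = ρ := fun ξ => by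
    rw [hinit]; simp [S.l₂_e₁, S.l₂_e₂]
  have hcont : ∀ t, 0 ≤ t → Continuous fun ξ => x ξ t := by
    intro t ht
    refine continuous_iff_continuousAt.2 fun ξ₀ => ?_
    rw [ContinuousAt, tendsto_iff_dist_tendsto_zero]
    have hbound : ∀ ξ, dist (x ξ t) (x ξ₀ t) ≤ dist (x ξ 0) (x ξ₀ 0) * Real.exp (K * t) :=
      fun ξ => dist_le_exp_of_lipschitzWith hK
        (fun s hs => (hx ξ s hs.1).mono Icc_subset_Ici_self)
        (fun s hs => (hx ξ₀ s hs.1).mono Icc_subset_Ici_self) ⟨ht, le_rfl⟩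
    have hc0 : Continuous fun ξ => dist (x ξ 0) (x ξ₀ 0) * Real.exp (K * t) := by
      simp only [hx0]; fun_prop
    have hlim := hc0.tendsto ξ₀
    simp only [dist_self, zero_mul] at hlim
    exact squeeze_zero (fun _ => dist_nonneg) hbound hlim
  have hopen : ∀ S' : EigenFrame A a b,
      IsOpen {ξ | ∃ t, 0 ≤ t ∧ |S'.l₂ (x ξ t - p)| < S'.l₁ (x ξ t - p)} := by
    intro S'
    have e : {ξ | ∃ t, 0 ≤ t ∧ |S'.l₂ (x ξ t - p)| < S'.l₁ (x ξ t - p)} =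
        ⋃ t, ⋃ (_ : 0 ≤ t), {ξ | |S'.l₂ (x ξ t - p)| < S'.l₁ (x ξ t - p)} := by
      ext ξ; simp
    rw [e]
    refine isOpen_iUnion fun t => isOpen_iUnion fun ht => ?_
    have hc := (hcont t ht).sub (continuous_const (y := p))
    exact isOpen_lt (S'.l₂.continuous.comp hc).abs (S'.l₁.continuous.comp hc)
  have hstay : ∃ ξ, ∀ t ∈ Ici (0 : ℝ), |S.l₁ (x ξ t - p)| ≤ |S.l₂ (x ξ t - p)| := by
    by_contra! hcon
    obtain ⟨ξ, -, ⟨t₁, ht₁, h₁⟩, ⟨t₂, ht₂, h₂⟩⟩ := isPreconnected_univ (α := ℝ) _ _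
      (hopen S) (hopen S.flip) (fun ξ _ => by
        obtain ⟨t, ht, hlt⟩ := hcon ξ
        rcases lt_abs.1 hlt with h | h
        · exact Or.inl ⟨t, ht, h⟩
        · exact Or.inr ⟨t, ht, by simpa [EigenFrame.flip] using h⟩)
      ⟨|ρ| + 1, trivial, 0, le_rfl, by rw [hy0, hz0]; linarith⟩
      ⟨-(|ρ| + 1), trivial, 0, le_rfl, by
        simp only [EigenFrame.flip, neg_apply]
        rw [hy0, hz0]; linarith⟩
    have hsmall' : ∀ t ∈ Ici (0 : ℝ),
        ‖F (x ξ t) - A (x ξ t - p)‖ ≤ S.flip.tolerance * ‖x ξ t - p‖ := by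
      rw [S.tolerance_flip]; exact hsmall ξ
    have g₁ := S.l₁_pos_of_mem_cone ha hb (hw ξ) (hsmall ξ) ht₁ (le_max_left t₁ t₂) h₁
    have g₂ := S.flip.l₁_pos_of_mem_cone ha hb (hw ξ) hsmall' ht₂ (le_max_right t₁ t₂) h₂
    simp only [EigenFrame.flip, neg_apply] at g₂
    linarith
  obtain ⟨ξ, hξ⟩ := hstay
  exact ⟨x ξ, hz0 ξ, hx ξ, hξ⟩

theorem norm_le_exp_of_stable_cone {A : Plane →L[ℝ] Plane} (S : EigenFrame A a b)
    (ha : 0 < a) (hb : b < 0) {w w' : ℝ → Plane}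
    (hw : ∀ t ∈ Ici 0, HasDerivWithinAt w (w' t) (Ici 0) t)
    (hsmall : ∀ t ∈ Ici 0, ‖w' t - A (w t)‖ ≤ S.tolerance * ‖w t‖)
    (hcone : ∀ t ∈ Ici 0, |S.l₁ (w t)| ≤ |S.l₂ (w t)|) {t : ℝ} (ht : 0 ≤ t) :
    ‖w t‖ ^ 2 ≤ 4 * S.l₂ (w 0) ^ 2 * Real.exp (b * t) := by
  have hm : 0 ≤ min a (-b) / 4 := div_nonneg (le_min ha.le (neg_pos.2 hb).le) (by norm_num)
  have h := le_exp_mul_of_deriv_le (h := fun t => S.l₂ (w t) ^ 2)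
    (h' := fun t => 2 * S.l₂ (w t) * S.l₂ (w' t)) (c := b) (T := 0)
    (fun t ht => ((S.l₂.hasFDerivAt.comp_hasDerivWithinAt t (hw t ht)).pow 2).congr_deriv
      (by simp))
    (fun t ht => stable_coord_deriv_bound hm (by linarith [min_le_right a (-b)]) (hcone t ht)
      (S.coord_bounds hm (hsmall t ht)).2) le_rfl ht
  simp only [sub_zero] at h
  have h1 : ‖w t‖ ≤ 2 * |S.l₂ (w t)| := (S.norm_le _).trans (by linarith [hcone t ht])
  have h2 := pow_le_pow_left₀ (norm_nonneg _) h1 2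
  rw [mul_pow, sq_abs] at h2
  linarith

theorem IsIncoming.shift (hU : IsOpen U) (hf : ContDiffOn ℝ 1 f U) (hpU : p ∈ U)
    (hp : f p = 0) {x : ℝ → Plane} (hx : IsIncoming f U p x) {T : ℝ} (hT : 0 ≤ T) :
    IsIncoming f U p (fun t => x (t + T)) :=
  ⟨hx.1.shift hT, hx.ne hU hf hpU hp (by simpa using hT),
    hx.2.2.comp (tendsto_atTop_add_const_right _ _ tendsto_id)⟩

theorem IsIncoming.continuousOn_coord {x : ℝ → Plane} (hx : IsIncoming f U p x)
    (l : Plane →L[ℝ] ℝ) : ContinuousOn (fun t => l (x t - p)) (Ici 0) :=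
  l.continuous.comp_continuousOn (hx.1.continuousOn.sub continuousOn_const)

theorem IsIncoming.tendsto_coord {x : ℝ → Plane} (hx : IsIncoming f U p x)
    (l : Plane →L[ℝ] ℝ) : Tendsto (fun t => l (x t - p)) atTop (𝓝 0) := by
  have := (l.continuous.tendsto (p - p)).comp (hx.2.2.sub_const p)
  simpa only [sub_self, map_zero, Function.comp_def] using this

section Local

variable {A : Plane →L[ℝ] Plane} (S : EigenFrame A a b) (ha : 0 < a) (hb : b < 0) {r : ℝ}
  (happ : ∀ x ∈ Metric.ball p r, ∀ y ∈ Metric.ball p r,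
    ‖f x - f y - A (x - y)‖ ≤ S.tolerance * ‖x - y‖)

include ha hb happ in
theorem IsIncoming.mem_stable_cone (hU : IsOpen U) (hf : ContDiffOn ℝ 1 f U) (hpU : p ∈ U)
    (hp : f p = 0) {x : ℝ → Plane} (hx : IsIncoming f U p x)
    (hxr : ∀ t, 0 ≤ t → x t ∈ Metric.ball p r) {t : ℝ} (ht : 0 ≤ t) :
    |S.l₁ (x t - p)| < |S.l₂ (x t - p)| := by
  rw [← S.form_neg_iff]
  by_contra! h
  have hpr : p ∈ Metric.ball p r :=
    Metric.mem_ball_self (dist_nonneg.trans_lt (Metric.mem_ball.1 (hxr t ht)))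
  have := S.eq_zero_of_tendsto_zero ha hb (w := fun t => x t - p) (w' := fun t => f (x t))
    (fun s hs => (hx.1 s hs).2.sub_const p)
    (fun s hs => by simpa [hp] using happ (x s) (hxr s hs) p hpr)
    (by simpa using hx.2.2.sub_const p) ht h
  exact hx.ne hU hf hpU hp ht (sub_eq_zero.1 this)

include ha hb happ in
-- Both stable coordinates are positive and tend to 0, so by the intermediate value theorem time
-- shifts make them equal at time 0. The difference of the shifted solutions then starts with form
-- l₁² ≥ 0 and tends to 0, so it vanishes at time 0.
theorem IsIncoming.sameIncoming_of_pos (hU : IsOpen U) (hf : ContDiffOn ℝ 1 f U)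
    {x y : ℝ → Plane} (hx : IsIncoming f U p x) (hy : IsIncoming f U p y)
    (hxr : ∀ t, 0 ≤ t → x t ∈ Metric.ball p r) (hyr : ∀ t, 0 ≤ t → y t ∈ Metric.ball p r)
    (hx2 : ∀ t, 0 ≤ t → 0 < S.l₂ (x t - p)) (hy2 : ∀ t, 0 ≤ t → 0 < S.l₂ (y t - p)) :
    SameIncoming x y := by
  obtain ⟨α, hα, hα0⟩ := (((hx.tendsto_coord S.l₂).eventually (gt_mem_nhds (hy2 0 le_rfl))).and
    (eventually_ge_atTop 0)).exists
  obtain ⟨τ, hτ, hτ0⟩ := (((hy.tendsto_coord S.l₂).eventually (gt_mem_nhds (hx2 α hα0))).and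
    (eventually_ge_atTop 0)).exists
  obtain ⟨β, hβ, hβeq⟩ := intermediate_value_Icc' hτ0
    ((hy.continuousOn_coord S.l₂).mono Icc_subset_Ici_self) ⟨hτ.le, hα.le⟩
  have hxs := hx.1.shift hα0
  have hys := hy.1.shift hβ.1
  have hlim : Tendsto (fun t => x (t + α) - y (t + β)) atTop (𝓝 0) := by
    have h1 := hx.2.2.comp (tendsto_atTop_add_const_right _ α tendsto_id)
    have h2 := hy.2.2.comp (tendsto_atTop_add_const_right _ β tendsto_id)
    simpa using h1.sub h2
  have hzero := S.eq_zero_of_tendsto_zero ha hb (w := fun t => x (t + α) - y (t + β))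
    (w' := fun t => f (x (t + α)) - f (y (t + β)))
    (fun t ht => (hxs t ht).2.sub (hys t ht).2)
    (fun t ht => happ _ (hxr _ (add_nonneg ht hα0)) _ (hyr _ (add_nonneg ht hβ.1)))
    hlim le_rfl (by
      have e : S.l₂ (x α - y β) = 0 := by
        have : x α - y β = (x α - p) - (y β - p) := by abel
        rw [this, map_sub]
        exact sub_eq_zero.2 hβeq.symm
      simp only [zero_add, EigenFrame.form, e]
      nlinarith [sq_nonneg (S.l₁ (x α - y β))])
  exact ⟨α, hα0, β, hβ.1, fun t ht =>
    IsSolutionOn.eqOn_Ici hU hf hxs hys le_rfl (sub_eq_zero.1 hzero) ht⟩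

end Local

/-- A solution which enters the equilibrium along the positive half of the stable direction. -/
theorem exists_incoming_half (hU : IsOpen U) (hf : ContDiffOn ℝ 1 f U) (hpU : p ∈ U)
    (hp : f p = 0) (S : EigenFrame (fderiv ℝ f p) a b) (ha : 0 < a) (hb : b < 0)
    {r : ℝ} (hr : 0 < r) (hrU : Metric.ball p r ⊆ U) {F : Plane → Plane} {K : NNReal}
    (hK : LipschitzWith K F) (hFf : EqOn F f (Metric.ball p r))
    (hF : ∀ x y, ‖F x - F y - fderiv ℝ f p (x - y)‖ ≤ S.tolerance * ‖x - y‖) :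
    ∃ s : ℝ → Plane, IsIncoming f U p s ∧ (∀ t, 0 ≤ t → s t ∈ Metric.ball p r) ∧
      (∀ t, 0 ≤ t → 0 < S.l₂ (s t - p)) ∧
      Tendsto (fun t => direction (s t - p)) atTop (𝓝 S.e₂) := by
  have hFp : F p = 0 := by rw [hFf (Metric.mem_ball_self hr), hp]
  -- In the stable cone the norm is at most twice the stable coordinate, so r/4 keeps the solution
  -- within r/2 of p.
  obtain ⟨x, hx0, hx, hcone⟩ := exists_solution_in_stable_cone S ha hb hK hFp hF (r / 4)
  have hest : ∀ t, 0 ≤ t → ‖x t - p‖ ^ 2 ≤ 4 * (r / 4) ^ 2 * Real.exp (b * t) := by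
    intro t ht
    rw [← hx0]
    exact norm_le_exp_of_stable_cone S ha hb (w := fun t => x t - p)
      (w' := fun t => F (x t)) (fun s hs => (hx s hs).sub_const p)
      (fun s _ => by simpa [hFp] using hF (x s) p) hcone ht
  have hball : ∀ t, 0 ≤ t → x t ∈ Metric.ball p r := by
    intro t ht
    rw [mem_ball_iff_norm]
    refine lt_of_pow_lt_pow_left₀ 2 hr.le ((hest t ht).trans_lt ?_)
    have h1 : Real.exp (b * t) ≤ 1 := Real.exp_le_one_iff.2 (by nlinarith)
    calc 4 * (r / 4) ^ 2 * Real.exp (b * t) ≤ 4 * (r / 4) ^ 2 * 1 := by gcongr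
      _ < r ^ 2 := by nlinarith [pow_pos hr 2]
  have hsol : IsSolutionOn f U x (Ici 0) := by
    intro t ht
    refine ⟨hrU (hball t ht), ?_⟩
    rw [← hFf (hball t ht)]
    exact hx t ht
  have hlim : Tendsto x atTop (𝓝 p) := by
    rw [tendsto_iff_norm_sub_tendsto_zero]
    have h0 : Tendsto (fun t : ℝ => 4 * (r / 4) ^ 2 * Real.exp (b * t)) atTop (𝓝 0) := by
      simpa using (tendsto_exp_neg_mul_sub (neg_pos.2 hb) 0).const_mul (4 * (r / 4) ^ 2)
    have h1 : Tendsto (fun t => ‖x t - p‖ ^ 2) atTop (𝓝 0) :=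
      tendsto_of_tendsto_of_tendsto_of_le_of_le' tendsto_const_nhds h0
        (Eventually.of_forall fun _ => sq_nonneg _)
        ((eventually_ge_atTop 0).mono fun t ht => hest t ht)
    simpa [Real.sqrt_sq] using h1.sqrt
  have hinc : IsIncoming f U p x := by
    refine ⟨hsol, fun h => ?_, hlim⟩
    rw [h, sub_self, map_zero] at hx0
    linarith
  have happ : ∀ x ∈ Metric.ball p r, ∀ y ∈ Metric.ball p r,
      ‖f x - f y - fderiv ℝ f p (x - y)‖ ≤ S.tolerance * ‖x - y‖ := fun x hx y hy => by
    rw [← hFf hx, ← hFf hy]; exact hF x y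
  have hstrict : ∀ t, 0 ≤ t → |S.l₁ (x t - p)| < |S.l₂ (x t - p)| := fun t ht =>
    hinc.mem_stable_cone S ha hb happ hU hf hpU hp hball ht
  have hpos : ∀ t, 0 ≤ t → 0 < S.l₂ (x t - p) := by
    intro t ht
    by_contra! hle
    obtain ⟨u, hu, hu0⟩ := intermediate_value_Icc' ht
      ((hinc.continuousOn_coord S.l₂).mono Icc_subset_Ici_self) ⟨hle, by rw [hx0]; positivity⟩
    have := hstrict u hu.1
    simp only at hu0
    rw [hu0, abs_zero] at this
    exact absurd (abs_nonneg _) (not_le.2 this)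
  refine ⟨x, hinc, hball, hpos, ?_⟩
  -- Tangency to the unstable axis would contradict membership in the stable cone.
  rcases S.dichotomy (hb.trans ha) (w := fun t => x t - p) (w' := fun t => f (x t))
    (fun t ht => (hsol t ht).2.sub_const p)
    (fun t ht => sub_ne_zero.2 (hinc.ne hU hf hpU hp ht))
    (fun ε hε => hinc.eventually_displacement_le hU hf hpU hp hε) with ⟨h1, h2⟩ | ⟨h1, h2⟩
  · exfalso
    obtain ⟨t, h3, h4, h5⟩ := (((Metric.tendsto_nhds.1 h2) 1 one_pos).and
      (h1.and (eventually_ge_atTop 0))).exists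
    rw [Real.dist_eq, sub_zero, abs_div, div_lt_one (abs_pos.2 h4)] at h3
    exact absurd h3 (not_lt.2 (hstrict t h5).le)
  · exact S.swap.tendsto_direction_of_pos
      ((eventually_ge_atTop 0).mono fun t ht => hpos t ht) h2

theorem SameIncoming.of_shift {x y : ℝ → Plane} {T : ℝ} (hT : 0 ≤ T)
    (h : SameIncoming (fun t => x (t + T)) y) : SameIncoming x y := by
  obtain ⟨α, hα, β, hβ, H⟩ := h
  exact ⟨α + T, add_nonneg hα hT, β, hβ, fun t ht => by
    rw [← add_assoc]; exact H t ht⟩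

/-- A saddle point has exactly two incoming trajectories, which are tangent to the two halves
of the stable direction. -/
theorem exists_two_incoming (hU : IsOpen U) (hf : ContDiffOn ℝ 1 f U) (hpU : p ∈ U)
    (hp : f p = 0) (S : EigenFrame (fderiv ℝ f p) a b) (ha : 0 < a) (hb : b < 0) :
    ∃ s₁ s₂ : ℝ → Plane, IsIncoming f U p s₁ ∧ IsIncoming f U p s₂ ∧
      (∀ x, IsIncoming f U p x → SameIncoming x s₁ ∨ SameIncoming x s₂) ∧
      Tendsto (fun t => direction (s₁ t - p)) atTop (𝓝 S.e₂) ∧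
      Tendsto (fun t => direction (s₂ t - p)) atTop (𝓝 (-S.e₂)) := by
  obtain ⟨r, hr, hrU, F, K, hK, hFf, hF⟩ :=
    exists_lipschitz_extension hU hf hpU (S.tolerance_pos ha hb)
  have hF₂ : ∀ x y, ‖F x - F y - fderiv ℝ f p (x - y)‖ ≤ S.flip₂.tolerance * ‖x - y‖ := by
    rw [S.tolerance_flip₂]; exact hF
  have happ : ∀ x ∈ Metric.ball p r, ∀ y ∈ Metric.ball p r,
      ‖f x - f y - fderiv ℝ f p (x - y)‖ ≤ S.tolerance * ‖x - y‖ := fun x hx y hy => by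
    rw [← hFf hx, ← hFf hy]; exact hF x y
  have happ₂ : ∀ x ∈ Metric.ball p r, ∀ y ∈ Metric.ball p r,
      ‖f x - f y - fderiv ℝ f p (x - y)‖ ≤ S.flip₂.tolerance * ‖x - y‖ := by
    rw [S.tolerance_flip₂]; exact happ
  obtain ⟨s₁, h₁, hr₁, hpos₁, hd₁⟩ := exists_incoming_half hU hf hpU hp S ha hb hr hrU hK hFf hF
  obtain ⟨s₂, h₂, hr₂, hpos₂, hd₂⟩ :=
    exists_incoming_half hU hf hpU hp S.flip₂ ha hb hr hrU hK hFf hF₂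
  refine ⟨s₁, s₂, h₁, h₂, fun x hx => ?_, hd₁, hd₂⟩
  -- A zero of the stable coordinate is impossible strictly inside the stable cone; its eventual
  -- sign then selects `s₁` or `s₂`.
  have hne : ∀ᶠ t in atTop, S.l₂ (x t - p) ≠ 0 := by
    obtain ⟨T, hT⟩ := eventually_atTop.1 (((Metric.tendsto_nhds.1 hx.2.2) r hr).and
      (eventually_ge_atTop 0))
    filter_upwards [eventually_ge_atTop T] with t ht h0
    have hT0 : 0 ≤ t := (hT t ht).2
    have := (hx.shift hU hf hpU hp hT0).mem_stable_cone S ha hb happ hU hf hpU hp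
      (fun s hs => (hT (s + t) (by linarith)).1) le_rfl
    simp only [zero_add, h0, abs_zero] at this
    exact absurd (abs_nonneg _) (not_le.2 this)
  rcases eventually_pos_or_neg (hx.continuousOn_coord S.l₂) hne with h | h
  · obtain ⟨T, hT⟩ := eventually_atTop.1 (h.and (((Metric.tendsto_nhds.1 hx.2.2) r hr).and
      (eventually_ge_atTop 0)))
    have hT0 : 0 ≤ T := (hT T le_rfl).2.2
    exact Or.inl (SameIncoming.of_shift hT0
      ((hx.shift hU hf hpU hp hT0).sameIncoming_of_pos S ha hb happ hU hf h₁
        (fun s hs => (hT (s + T) (by linarith)).2.1) hr₁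
        (fun s hs => (hT (s + T) (by linarith)).1) hpos₁))
  · obtain ⟨T, hT⟩ := eventually_atTop.1 (h.and (((Metric.tendsto_nhds.1 hx.2.2) r hr).and
      (eventually_ge_atTop 0)))
    have hT0 : 0 ≤ T := (hT T le_rfl).2.2
    exact Or.inr (SameIncoming.of_shift hT0
      ((hx.shift hU hf hpU hp hT0).sameIncoming_of_pos S.flip₂ ha hb happ₂ hU hf h₂
        (fun s hs => (hT (s + T) (by linarith)).2.1) hr₂
        (fun s hs => by
          have := (hT (s + T) (by linarith)).1
          simpa [EigenFrame.flip₂, EigenFrame.flip, EigenFrame.swap] using this) hpos₂))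

end StableManifold

/-! ### Eigenbases for distinct real eigenvalues -/

section Eigenvectors

theorem exists_kernel_vector {α β γ δ : ℝ} (h : α * δ - β * γ = 0) :
    ∃ u v : ℝ, (u ≠ 0 ∨ v ≠ 0) ∧ α * u + β * v = 0 ∧ γ * u + δ * v = 0 := by
  by_cases h1 : β ≠ 0 ∨ α ≠ 0
  · exact ⟨β, -α, h1.imp id neg_ne_zero.2, by ring, by linear_combination -h⟩
  · push Not at h1
    obtain ⟨rfl, rfl⟩ := h1
    by_cases h2 : δ ≠ 0 ∨ γ ≠ 0
    · exact ⟨δ, -γ, h2.imp id neg_ne_zero.2, by ring, by ring⟩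
    · push Not at h2
      obtain ⟨rfl, rfl⟩ := h2
      exact ⟨1, 0, Or.inl one_ne_zero, by ring, by ring⟩

variable {A : Plane →L[ℝ] Plane} {α β γ δ : ℝ}

theorem exists_unit_eigenvector (h0 : ∀ w, A w 0 = α * w 0 + β * w 1)
    (h1 : ∀ w, A w 1 = γ * w 0 + δ * w 1) {a : ℝ} (h : (α - a) * (δ - a) - β * γ = 0) :
    ∃ e : Plane, ‖e‖ = 1 ∧ A e = a • e := by
  obtain ⟨u, v, hne, hu, hv⟩ := exists_kernel_vector h
  set w : Plane := !₂[u, v] with hw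
  have hw0 : w ≠ 0 := fun h => by
    have e0 : w 0 = 0 := by rw [h]; rfl
    have e1 : w 1 = 0 := by rw [h]; rfl
    simp only [hw, PiLp.toLp_apply, Matrix.cons_val_zero, Matrix.cons_val_one] at e0 e1
    exact hne.elim (fun h => h e0) (fun h => h e1)
  have hA : A w = a • w := by
    ext i
    fin_cases i
    · have := h0 w
      simp [hw] at this ⊢
      linarith
    · have := h1 w
      simp [hw] at this ⊢
      linarith
  refine ⟨‖w‖⁻¹ • w, ?_, by rw [map_smul, hA, smul_comm]⟩
  rw [norm_smul, norm_inv, norm_norm, inv_mul_cancel₀ (norm_ne_zero_iff.2 hw0)]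

theorem coord_sq_add_sq {e : Plane} (he : ‖e‖ = 1) : e 0 ^ 2 + e 1 ^ 2 = 1 := by
  rw [← norm_sq_plane, he, one_pow]

/-- A plane linear map with distinct real eigenvalues has an eigenbasis. -/
theorem nonempty_eigenFrame (h0 : ∀ w, A w 0 = α * w 0 + β * w 1)
    (h1 : ∀ w, A w 1 = γ * w 0 + δ * w 1) {a b : ℝ} (hab : a ≠ b) (htr : a + b = α + δ)
    (hdet : a * b = α * δ - β * γ) : Nonempty (EigenFrame A a b) := by
  obtain ⟨e₁, hn₁, hA₁⟩ := exists_unit_eigenvector h0 h1 (a := a)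
    (by linear_combination a * htr - hdet)
  obtain ⟨e₂, hn₂, hA₂⟩ := exists_unit_eigenvector h0 h1 (a := b)
    (by linear_combination b * htr - hdet)
  set D : ℝ := e₁ 0 * e₂ 1 - e₁ 1 * e₂ 0 with hD
  have hs := coord_sq_add_sq hn₁
  -- Parallel eigenvectors would make `e₂` an eigenvector for both a and b.
  have hD0 : D ≠ 0 := by
    intro hD0
    rw [hD] at hD0
    have hpar : e₂ = (e₁ 0 * e₂ 0 + e₁ 1 * e₂ 1) • e₁ := by
      ext i
      fin_cases i
      · simp only [Fin.zero_eta, PiLp.smul_apply, smul_eq_mul]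
        linear_combination (-e₂ 0) * hs - e₁ 1 * hD0
      · simp only [Fin.mk_one, PiLp.smul_apply, smul_eq_mul]
        linear_combination (-e₂ 1) * hs + e₁ 0 * hD0
    have hA : A e₂ = a • e₂ := by
      rw [hpar, map_smul, hA₁, smul_comm]
    have h : (a - b) • e₂ = 0 := by rw [sub_smul, ← hA, ← hA₂, sub_self]
    have he₂ : e₂ = 0 := (smul_eq_zero.1 h).resolve_left (sub_ne_zero.2 hab)
    simp [he₂] at hn₂
  -- The dual basis, by Cramer's rule.
  set l₁ : Plane →L[ℝ] ℝ := (e₂ 1 / D) • EuclideanSpace.proj 0 - (e₂ 0 / D) • EuclideanSpace.proj 1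
    with hl₁
  set l₂ : Plane →L[ℝ] ℝ := (e₁ 0 / D) • EuclideanSpace.proj 1 - (e₁ 1 / D) • EuclideanSpace.proj 0
    with hl₂
  have v₁ : ∀ w, l₁ w = (e₂ 1 * w 0 - e₂ 0 * w 1) / D := fun w => by
    simp [hl₁]; ring
  have v₂ : ∀ w, l₂ w = (e₁ 0 * w 1 - e₁ 1 * w 0) / D := fun w => by
    simp [hl₂]; ring
  have e11 : l₁ e₁ = 1 := by rw [v₁, div_eq_one_iff_eq hD0, hD]; ring
  have e12 : l₁ e₂ = 0 := by rw [v₁, div_eq_zero_iff]; left; ring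
  have e21 : l₂ e₁ = 0 := by rw [v₂, div_eq_zero_iff]; left; ring
  have e22 : l₂ e₂ = 1 := by rw [v₂, div_eq_one_iff_eq hD0]
  have hdec : ∀ w, l₁ w • e₁ + l₂ w • e₂ = w := by
    intro w
    ext i
    fin_cases i
    · simp only [Fin.zero_eta, PiLp.add_apply, PiLp.smul_apply, smul_eq_mul, v₁, v₂]
      field_simp
      rw [hD]; ring
    · simp only [Fin.mk_one, PiLp.add_apply, PiLp.smul_apply, smul_eq_mul, v₁, v₂]
      field_simp
      rw [hD]; ring
  have hmap : ∀ w, A w = (a * l₁ w) • e₁ + (b * l₂ w) • e₂ := fun w => by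
    conv_lhs => rw [← hdec w]
    rw [map_add, map_smul, map_smul, hA₁, hA₂, smul_smul, smul_smul, mul_comm a, mul_comm b]
  exact ⟨⟨e₁, e₂, l₁, l₂, hn₁, hn₂, e11, e12, e21, e22,
    fun w => by rw [hmap, map_add, map_smul, map_smul, e11, e12]; simp,
    fun w => by rw [hmap, map_add, map_smul, map_smul, e21, e22]; simp, hdec⟩⟩

theorem EigenFrame.cross_ne_zero {a b : ℝ} (S : EigenFrame A a b) :
    S.e₁ 0 * S.e₂ 1 - S.e₁ 1 * S.e₂ 0 ≠ 0 := by
  intro h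
  have hzero : ∀ i, S.e₂ i = 0 := by
    intro i
    have hrel : S.e₂ i • S.e₁ - S.e₁ i • S.e₂ = 0 := by
      ext j
      fin_cases i <;> fin_cases j <;>
        simp only [Fin.zero_eta, Fin.mk_one, PiLp.sub_apply, PiLp.smul_apply, smul_eq_mul,
          PiLp.zero_apply] <;> linarith
    have := congrArg S.l₁ hrel
    simpa [S.l₁_e₁, S.l₁_e₂] using this
  have he : S.e₂ = 0 := by ext i; exact hzero i
  have := S.norm_e₂
  simp [he] at this

end Eigenvectors

/-! ### Saddles: outgoing trajectories and cyclic order -/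

section Saddle

theorem exists_unitAt_eq {e : Plane} (he : ‖e‖ = 1) : ∃ θ, unitAt θ = e := by
  have hne : toComplex e ≠ 0 := toComplex_ne_zero fun h => by simp [h] at he
  have hnorm : ‖toComplex e‖ = 1 := by
    rw [← sq_eq_sq₀ (norm_nonneg _) zero_le_one, ← Complex.normSq_eq_norm_sq,
      normSq_toComplex, he]
  refine ⟨Complex.arg (toComplex e), ?_⟩
  ext i
  fin_cases i
  · simp [unitAt, Complex.cos_arg hne, hnorm, toComplex_re]
  · simp [unitAt, Complex.sin_arg, hnorm, toComplex_im]

/-- The oriented angle between unit vectors in positive position. -/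
theorem exists_angles_of_cross_pos {e₁ e₂ : Plane} (h₁ : ‖e₁‖ = 1) (h₂ : ‖e₂‖ = 1)
    (hpos : 0 < e₁ 0 * e₂ 1 - e₁ 1 * e₂ 0) :
    ∃ θ φ : ℝ, θ < φ ∧ φ < θ + Real.pi ∧ unitAt θ = e₁ ∧ unitAt φ = e₂ := by
  obtain ⟨θ, hθ⟩ := exists_unitAt_eq h₁
  set D := e₁ 0 * e₂ 1 - e₁ 1 * e₂ 0 with hD
  set k := e₁ 0 * e₂ 0 + e₁ 1 * e₂ 1 with hk
  have s₁ := coord_sq_add_sq h₁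
  have s₂ := coord_sq_add_sq h₂
  -- Lagrange's identity: k and D are the cosine and sine of the oriented angle, and D > 0 makes
  -- `arccos k` that angle.
  have hkD : k ^ 2 + D ^ 2 = 1 := by
    rw [hk, hD]
    linear_combination (e₂ 0 ^ 2 + e₂ 1 ^ 2) * s₁ + s₂
  have hcos : Real.cos (Real.arccos k) = k := Real.cos_arccos (by nlinarith) (by nlinarith)
  have hsin : Real.sin (Real.arccos k) = D := by
    rw [Real.sin_arccos, show 1 - k ^ 2 = D ^ 2 by linarith, Real.sqrt_sq hpos.le]
  have hne0 : Real.arccos k ≠ 0 := fun h => by rw [h, Real.sin_zero] at hsin; linarith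
  have hnepi : Real.arccos k ≠ Real.pi := fun h => by rw [h, Real.sin_pi] at hsin; linarith
  have hlt := lt_of_le_of_ne (Real.arccos_nonneg k) hne0.symm
  have hltpi := lt_of_le_of_ne (Real.arccos_le_pi k) hnepi
  refine ⟨θ, θ + Real.arccos k, by linarith, by linarith, hθ, ?_⟩
  have hc : Real.cos θ = e₁ 0 := by rw [← hθ]; simp [unitAt]
  have hs : Real.sin θ = e₁ 1 := by rw [← hθ]; simp [unitAt]
  ext i
  fin_cases i
  · simp only [unitAt, Fin.zero_eta, PiLp.toLp_apply, Matrix.cons_val_zero]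
    rw [Real.cos_add, hcos, hsin, hc, hs]
    linear_combination e₂ 0 * s₁
  · simp only [unitAt, Fin.mk_one, PiLp.toLp_apply, Matrix.cons_val_one,
      Matrix.cons_val_fin_one]
    rw [Real.sin_add, hcos, hsin, hc, hs]
    linear_combination e₂ 1 * s₁

variable {f : Plane → Plane} {U : Set Plane} {p : Plane} {a b : ℝ}

/-- A saddle point has exactly two outgoing trajectories, which are tangent to the two halves
of the unstable direction. -/
theorem exists_two_outgoing (hU : IsOpen U) (hf : ContDiffOn ℝ 1 f U) (hpU : p ∈ U)
    (hp : f p = 0) (S : EigenFrame (fderiv ℝ f p) a b) (ha : 0 < a) (hb : b < 0) :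
    ∃ u₁ u₂ : ℝ → Plane, IsOutgoing f U p u₁ ∧ IsOutgoing f U p u₂ ∧
      (∀ x, IsOutgoing f U p x → SameOutgoing x u₁ ∨ SameOutgoing x u₂) ∧
      Tendsto (fun t => direction (u₁ t - p)) atBot (𝓝 S.e₁) ∧
      Tendsto (fun t => direction (u₂ t - p)) atBot (𝓝 (-S.e₁)) := by
  have hd : -fderiv ℝ f p = fderiv ℝ (-f) p := (fderiv_pi_neg f p).symm
  obtain ⟨S', hS'⟩ : ∃ S' : EigenFrame (fderiv ℝ (-f) p) (-b) (-a), S'.e₂ = S.e₁ := by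
    rw [← hd]; exact ⟨S.swap.neg, rfl⟩
  obtain ⟨s₁, s₂, h₁, h₂, hall, d₁, d₂⟩ := exists_two_incoming hU hf.neg hpU (by simp [hp]) S'
    (neg_pos.2 hb) (neg_neg_of_pos ha)
  rw [hS'] at d₁ d₂
  have hsame : ∀ {x s : ℝ → Plane}, SameIncoming (fun t => x (-t)) s →
      SameOutgoing x (fun t => s (-t)) := by
    rintro x s ⟨α, hα, β, hβ, H⟩
    refine ⟨α, hα, β, hβ, fun t ht => ?_⟩
    have := H (-t) (neg_nonneg.2 ht)
    simp only [neg_add, neg_neg] at this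
    simpa [sub_eq_add_neg, add_comm] using this
  exact ⟨fun t => s₁ (-t), fun t => s₂ (-t), h₁.reverse, h₂.reverse,
    fun x hx => (hall _ hx.reverse).imp hsame hsame,
    d₁.comp tendsto_neg_atBot_atTop, d₂.comp tendsto_neg_atBot_atTop⟩

/-- When the stable direction φ lies less than a half turn after the unstable direction θ, the
angles θ, φ, θ + π, φ + π are in increasing order within one turn. The other orientation is reduced
to this one by reversing `e₂`. -/
theorem isSaddle_of_cross_pos (hU : IsOpen U) (hf : ContDiffOn ℝ 1 f U) (hpU : p ∈ U)
    (hp : f p = 0) (S : EigenFrame (fderiv ℝ f p) a b) (ha : 0 < a) (hb : b < 0)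
    (hpos : 0 < S.e₁ 0 * S.e₂ 1 - S.e₁ 1 * S.e₂ 0) : IsSaddle f U p := by
  obtain ⟨u₁, u₂, hu₁, hu₂, hu, du₁, du₂⟩ := exists_two_outgoing hU hf hpU hp S ha hb
  obtain ⟨s₁, s₂, hs₁, hs₂, hs, ds₁, ds₂⟩ := exists_two_incoming hU hf hpU hp S ha hb
  obtain ⟨θ, φ, h1, h2, e1, e2⟩ := exists_angles_of_cross_pos S.norm_e₁ S.norm_e₂ hpos
  rw [← e1] at du₁ du₂
  rw [← e2] at ds₁ ds₂
  rw [neg_unitAt] at du₂ ds₂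
  exact ⟨u₁, s₁, u₂, s₂, hu₁, hu₂, hu, hs₁, hs₂, hs, θ, φ, θ + Real.pi, φ + Real.pi, h1, h2,
    by linarith, by linarith, du₁, ds₁, du₂, ds₂⟩

theorem isSaddle_of_eigenFrame (hU : IsOpen U) (hf : ContDiffOn ℝ 1 f U) (hpU : p ∈ U)
    (hp : f p = 0) (S : EigenFrame (fderiv ℝ f p) a b) (ha : 0 < a) (hb : b < 0) :
    IsSaddle f U p := by
  rcases lt_or_gt_of_ne S.cross_ne_zero with h | h
  · refine isSaddle_of_cross_pos hU hf hpU hp S.flip₂ ha hb ?_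
    simp only [EigenFrame.flip₂, EigenFrame.flip, EigenFrame.swap, PiLp.neg_apply]
    linarith
  · exact isSaddle_of_cross_pos hU hf hpU hp S ha hb h

end Saddle

/-! ### From eigenvalues to the three cases -/

section Eigenvalues

theorem fderiv_apply_eq_jacobian (f : Plane → Plane) (p w : Plane) (i : Fin 2) :
    fderiv ℝ f p w i = jacobian f p i 0 * w 0 + jacobian f p i 1 * w 1 := by
  have hw : w = w 0 • EuclideanSpace.single 0 1 + w 1 • EuclideanSpace.single 1 1 := by
    ext j; fin_cases j <;> simp
  conv_lhs => rw [hw]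
  rw [map_add, map_smul, map_smul]
  simp [jacobian, mul_comm]

/-- The trace and the determinant in terms of two distinct roots of the characteristic
polynomial. -/
theorem add_mul_eq_of_charpoly_roots {M : Matrix (Fin 2) (Fin 2) ℝ} {lam₁ lam₂ : ℂ}
    (heig : (M.map (algebraMap ℝ ℂ)).charpoly.roots = {lam₁, lam₂}) (hne : lam₁ ≠ lam₂) :
    lam₁ + lam₂ = ((M 0 0 + M 1 1 : ℝ) : ℂ) ∧
      lam₁ * lam₂ = ((M 0 0 * M 1 1 - M 0 1 * M 1 0 : ℝ) : ℂ) := by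
  have hroot : ∀ z ∈ ({lam₁, lam₂} : Multiset ℂ),
      z ^ 2 - (M 0 0 + M 1 1) * z + (M 0 0 * M 1 1 - M 0 1 * M 1 0) = 0 := by
    intro z hz
    rw [← heig] at hz
    have := (Polynomial.mem_roots'.1 hz).2
    rw [Polynomial.IsRoot.def, Matrix.charpoly_fin_two, Matrix.trace_fin_two,
      Matrix.det_fin_two] at this
    simpa using this
  have r1 := hroot lam₁ (by simp)
  have r2 := hroot lam₂ (by simp)
  have hsum : lam₁ + lam₂ = M 0 0 + M 1 1 := by
    have : (lam₁ - lam₂) * (lam₁ + lam₂ - (M 0 0 + M 1 1)) = 0 := by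
      linear_combination r1 - r2
    exact sub_eq_zero.1 ((mul_eq_zero.1 this).resolve_left (sub_ne_zero.2 hne))
  push_cast
  exact ⟨hsum, by linear_combination lam₁ * hsum - r1⟩

end Eigenvalues

theorem theorem1 (U : Set Plane) (hU : IsOpen U) (f : Plane → Plane) (hf : ContDiffOn ℝ 1 f U)
    (p : Plane) (hpU : p ∈ U) (hp : f p = 0) (lam₁ lam₂ : ℂ)
    (heig : ((jacobian f p).map (algebraMap ℝ ℂ)).charpoly.roots = {lam₁, lam₂})
    (hne : lam₁ ≠ lam₂) :
    (lam₁.im = 0 → lam₂.im = 0 → 0 < lam₁.re * lam₂.re → IsNode f U p) ∧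
    (lam₁.im = 0 → lam₂.im = 0 → lam₁.re * lam₂.re < 0 → IsSaddle f U p) ∧
    (lam₁.im ≠ 0 → lam₂.im ≠ 0 → lam₁.re ≠ 0 → lam₂.re ≠ 0 → IsFocus f U p) := by
  obtain ⟨hsum, hprod⟩ := add_mul_eq_of_charpoly_roots heig hne
  have h0 := fun w => fderiv_apply_eq_jacobian f p w 0
  have h1 := fun w => fderiv_apply_eq_jacobian f p w 1
  have hsr := congrArg Complex.re hsum
  have hsi := congrArg Complex.im hsum
  have hpr := congrArg Complex.re hprod
  have hpi := congrArg Complex.im hprod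
  simp only [Complex.add_re, Complex.add_im, Complex.mul_re, Complex.mul_im,
    Complex.ofReal_re, Complex.ofReal_im] at hsr hsi hpr hpi
  have hframe : lam₁.im = 0 → lam₂.im = 0 →
      lam₁.re ≠ lam₂.re ∧ Nonempty (EigenFrame (fderiv ℝ f p) lam₁.re lam₂.re) := by
    intro i1 i2
    have hre : lam₁.re ≠ lam₂.re := fun h => hne (Complex.ext h (i1.trans i2.symm))
    refine ⟨hre, nonempty_eigenFrame h0 h1 hre hsr ?_⟩
    rw [i1, zero_mul, sub_zero] at hpr
    exact hpr
  refine ⟨fun i1 i2 hpos => ?_, fun i1 i2 hneg => ?_, fun i1 i2 hr1 hr2 => ?_⟩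
  · obtain ⟨hre, ⟨S⟩⟩ := hframe i1 i2
    rcases lt_or_gt_of_ne hre with h | h
    · exact isNode_of_eigenFrame hU hf hpU hp S.swap h (by rwa [mul_comm])
    · exact isNode_of_eigenFrame hU hf hpU hp S h hpos
  · obtain ⟨-, ⟨S⟩⟩ := hframe i1 i2
    rcases mul_neg_iff.1 hneg with ⟨ha, hb⟩ | ⟨ha, hb⟩
    · exact isSaddle_of_eigenFrame hU hf hpU hp S ha hb
    · exact isSaddle_of_eigenFrame hU hf hpU hp S.swap hb ha
  -- Real trace and determinant force the eigenvalues to be conjugate; the discriminant expression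
  -- is then minus the square of the imaginary part.
  · have i2' : lam₂.im = -lam₁.im := by linarith
    have hre : lam₁.re = lam₂.re := by
      have : lam₁.im * (lam₂.re - lam₁.re) = 0 := by rw [i2'] at hpi; linarith
      have := (mul_eq_zero.1 this).resolve_left i1
      linarith
    refine isFocus_of_neg_discrim hU hf hpU hp h0 h1 ?_ fun h => hr1 (by linarith)
    rw [i2', ← hre] at hpr
    rw [← hre] at hsr
    have hsq : 0 < lam₁.im ^ 2 := by positivity
    have e : ((jacobian f p 0 0 - jacobian f p 1 1) / 2) ^ 2 +
        jacobian f p 0 1 * jacobian f p 1 0 = -lam₁.im ^ 2 := by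
      linear_combination (-(jacobian f p 0 0 + jacobian f p 1 1 + 2 * lam₁.re) / 4) * hsr + hpr
    rw [e]; linarith
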